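/- Let $\mathbb{K}\in\{\mathbb{R},\mathbb{C}\}$ and let $\ell,n,m\ge 1$ be integers. *Relative genericity.* A set $\mathbb{V}\subseteq\mathbb{R}^d$ is *algebraic* if it is the set of common zeros of finitely many polynomials in $\mathbb{R}[x_1,\dots,x_d]$. For $S,V\subseteq\mathbb{R}^d$, the set $S$ is *relative generic in* $V$ if there is an algebraic set $\mathbb{V}\subseteq\mathbb{R}^d$ such that $S^c\cap V\subseteq\mathbb{V}\cap V$ and $\mathbb{V}^c\cap V$ is dense in $V$ in the Euclidean topology. For subsets of a finite-dimensional $\mathbb{K}$-vector space the notion is defined by identifying that space with some $\mathbb{R}^d$ through a real-linear isomorphism (the choice of which is immaterial). *Reference sets.* With $E,Q\in\mathbb{K}^{\ell\times n}$, $J,R\in\mathbb{K}^{\ell\times\ell}$, $B\in\mathbb{K}^{\ell\times m}$, and $M^*$ the conjugate transpose of $M$, put $$\Sigma^{H}=\{(E,J,Q,B)\mid J=-J^*,\ E^*Q=Q^*E\ge 0\},$$ $$\Sigma^{sdH}=\{(E,J,R,Q,B)\mid J=-J^*,\ R=R^*\ge 0,\ E^*Q=Q^*E\ge 0\},$$ $$\Sigma^{dH}=\{(E,J,R,Q,B)\mid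 J=-J^*,\ R=R^*> 0,\ E^*Q=Q^*E\ge 0\},$$ where $\ge 0$ and $>0$ mean positive semidefinite and positive definite. Then the following hold. 1. Each of the sets - (a) $S_{(a)}=\{(E,J,Q,B)\mid \operatorname{rk}[E,B]=\min\{\ell,n+m\}\}$, - (b) $S_{(b)}=\{(E,J,Q,B)\mid \operatorname{rk}[E,JQ,B]=\min\{\ell,2n+m\}\}$, - (c) $S_{(c)}=\{(E,J,Q,B)\mid \operatorname{rk}_{\mathbb{K}(x)}[xE-JQ,B]=\min\{\ell,n+m\}\}$, - (d) $S_{(d)}=\{(E,J,Q,B)\mid \operatorname{rk}[E,JQZ,B]=\min\{\ell,n+m\}$ for all $Z\in\mathbb{K}^{n\times(n-\operatorname{rk}E)}$ with $\operatorname{im}Z=\ker E\}$ is relative generic in $\Sigma^{H}$. 2. Each of the sets - (e) $S_{(e)}=\{(E,J,R,Q,B)\mid \operatorname{rk}[E,B]=\min\{\ell,n+m\}\}$, - (f) $S_{(f)}=\{(E,J,R,Q,B)\mid \operatorname{rk}[E,(J-R)Q,B]=\min\{\ell,2n+m\}\}$, - (g) $S_{(g)}=\{(E,J,R,Q,B)\mid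 \operatorname{rk}_{\mathbb{K}(x)}[xE-(J-R)Q,B]=\min\{\ell,n+m\}\}$, - (h) $S_{(h)}=\{(E,J,R,Q,B)\mid \operatorname{rk}[E,(J-R)QZ,B]=\min\{\ell,n+m\}$ for all $Z\in\mathbb{K}^{n\times(n-\operatorname{rk}E)}$ with $\operatorname{im}Z=\ker E\}$ is relative generic in $\Sigma^{sdH}$ and in $\Sigma^{dH}$. 3. The set - (i) $S_{(i)}=\{(E,J,Q,B)\mid \forall\lambda\in\mathbb{C}:\ \operatorname{rk}_{\mathbb{C}}[\lambda E-JQ,B]=\min\{\ell,n+m\}\}$ is relative generic in $\Sigma^{H}$ if and only if $\ell\neq n+m$; if $\ell=n+m$, its complement is relative generic in $\Sigma^{H}$. The set - (j) $S_{(j)}=\{(E,J,R,Q,B)\mid \forall\lambda\in\mathbb{C}:\ \operatorname{rk}_{\mathbb{C}}[\lambda E-(J-R)Q,B]=\min\{\ell,n+m\}\}$ is relative generic in $\Sigma^{sdH}$ if and only if $\ell\neq n+m$; if $\ell=n+m$, its complement is relative generic in $\Sigma^{sdH}$. -/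

import Mathlib

open scoped ComplexOrder

noncomputable section

namespace PortHamiltonian

/-! ### Algebraic sets and relative genericity -/

/-- A subset of `ℝ^d` is algebraic if it is the set of common zeros of finitely many real
polynomials in `d` indeterminates. -/
def IsAlgebraicSet {d : ℕ} (A : Set (Fin d → ℝ)) : Prop :=
  ∃ s : Finset (MvPolynomial (Fin d) ℝ), A = {x | ∀ p ∈ s, MvPolynomial.eval x p = 0}

/-- `S` is relative generic in the reference set `V`, both subsets of `ℝ^d`: outside of some
algebraic set `A` every point of `V` lies in `S`, and `Aᶜ ∩ V` is Euclidean dense in `V`. -/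
def IsRelGenericReal {d : ℕ} (S V : Set (Fin d → ℝ)) : Prop :=
  ∃ A : Set (Fin d → ℝ), IsAlgebraicSet A ∧ Sᶜ ∩ V ⊆ A ∩ V ∧ V ⊆ closure (Aᶜ ∩ V)

/-- Relative genericity in a finite-dimensional real vector space `W` (for instance a complex
coordinate space, regarded as a real vector space), through a real-linear isomorphism of `W`
with some `ℝ^d`. By `isRelGeneric_iff` below the choice of the isomorphism is immaterial. -/
def IsRelGeneric {W : Type*} [AddCommGroup W] [Module ℝ W] [Module.Finite ℝ W]
    (S V : Set W) : Prop :=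
  IsRelGenericReal ((Module.finBasis ℝ W).equivFun '' S) ((Module.finBasis ℝ W).equivFun '' V)

/-- Preimages of algebraic sets under linear maps are algebraic. -/
theorem IsAlgebraicSet.preimage {d e : ℕ} {A : Set (Fin e → ℝ)} (hA : IsAlgebraicSet A)
    (f : (Fin d → ℝ) →ₗ[ℝ] (Fin e → ℝ)) : IsAlgebraicSet (f ⁻¹' A) := by
  classical
  obtain ⟨s, rfl⟩ := hA
  let g : Fin e → MvPolynomial (Fin d) ℝ := fun j =>
    ∑ i, MvPolynomial.C (f (Pi.single i 1) j) * MvPolynomial.X i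
  have hg : ∀ x j, MvPolynomial.eval x (g j) = f x j := by
    intro x j
    have hx : f x = ∑ i, x i • f (Pi.single i 1) := by
      conv_lhs => rw [pi_eq_sum_univ' x]
      simp [map_sum, map_smul]
    rw [hx]
    simp [g, Finset.sum_apply, mul_comm]
  refine ⟨s.image (MvPolynomial.bind₁ g), ?_⟩
  ext x
  have key : ∀ p, MvPolynomial.eval x (MvPolynomial.bind₁ g p) = MvPolynomial.eval (f x) p := by
    intro p
    rw [MvPolynomial.eval, MvPolynomial.eval₂Hom_bind₁]
    have : (fun i => (MvPolynomial.eval₂Hom (RingHom.id ℝ) x) (g i)) = f x := funext (hg x)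
    rw [this]
    rfl
  simp [key]

theorem IsRelGenericReal.image {d e : ℕ} {S V : Set (Fin d → ℝ)} (h : IsRelGenericReal S V)
    (f : (Fin d → ℝ) ≃ₗ[ℝ] (Fin e → ℝ)) : IsRelGenericReal (f '' S) (f '' V) := by
  obtain ⟨A, hA, hS, hV⟩ := h
  have hfA : (f.symm : (Fin e → ℝ) →ₗ[ℝ] (Fin d → ℝ)) ⁻¹' A = f '' A :=
    (f.toEquiv.image_eq_preimage_symm A).symm
  refine ⟨f '' A, hfA ▸ hA.preimage (f.symm : (Fin e → ℝ) →ₗ[ℝ] (Fin d → ℝ)), ?_, ?_⟩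
  · rw [← Set.image_compl_eq f.bijective, ← Set.image_inter f.injective,
      ← Set.image_inter f.injective]
    exact Set.image_mono hS
  · rw [← Set.image_compl_eq f.bijective, ← Set.image_inter f.injective]
    have hc : Continuous f := (f : (Fin d → ℝ) →ₗ[ℝ] (Fin e → ℝ)).continuous_of_finiteDimensional
    exact (Set.image_mono hV).trans (image_closure_subset_closure_image hc)

/-- Relative genericity does not depend on the isomorphism used to define it. -/
theorem isRelGeneric_iff {W : Type*} [AddCommGroup W] [Module ℝ W] [Module.Finite ℝ W]
    (S V : Set W) {d : ℕ} (φ : W ≃ₗ[ℝ] (Fin d → ℝ)) :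
    IsRelGeneric S V ↔ IsRelGenericReal (φ '' S) (φ '' V) := by
  constructor
  · intro h
    have := IsRelGenericReal.image h ((Module.finBasis ℝ W).equivFun.symm.trans φ)
    simpa [Set.image_image] using this
  · intro h
    have := IsRelGenericReal.image h (φ.symm.trans (Module.finBasis ℝ W).equivFun)
    simp only [Set.image_image, LinearEquiv.trans_apply, LinearEquiv.symm_apply_apply] at this
    exact this

/-! ### Port-Hamiltonian matrix tuples -/

variable (𝕜 : Type*) [RCLike 𝕜] (ℓ n m : ℕ)

/-- Quadruples `(E, J, Q, B)` of matrices. -/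
abbrev Quadruple : Type _ :=
  Matrix (Fin ℓ) (Fin n) 𝕜 × Matrix (Fin ℓ) (Fin ℓ) 𝕜 × Matrix (Fin ℓ) (Fin n) 𝕜 ×
    Matrix (Fin ℓ) (Fin m) 𝕜

/-- Quintuples `(E, J, R, Q, B)` of matrices. -/
abbrev Quintuple : Type _ :=
  Matrix (Fin ℓ) (Fin n) 𝕜 × Matrix (Fin ℓ) (Fin ℓ) 𝕜 × Matrix (Fin ℓ) (Fin ℓ) 𝕜 ×
    Matrix (Fin ℓ) (Fin n) 𝕜 × Matrix (Fin ℓ) (Fin m) 𝕜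

instance finite_matrix (a b : ℕ) : Module.Finite ℝ (Matrix (Fin a) (Fin b) 𝕜) :=
  inferInstanceAs (Module.Finite ℝ (Fin a → Fin b → 𝕜))

open Matrix in
/-- Conservative port-Hamiltonian systems. -/
def SigmaH : Set (Quadruple 𝕜 ℓ n m) :=
  {(E, J, Q, _B) : Quadruple 𝕜 ℓ n m | J = -Jᴴ ∧ Eᴴ * Q = Qᴴ * E ∧ (Eᴴ * Q).PosSemidef}

open Matrix in
/-- Semi-dissipative port-Hamiltonian systems. -/
def SigmaSdH : Set (Quintuple 𝕜 ℓ n m) :=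
  {(E, J, R, Q, _B) : Quintuple 𝕜 ℓ n m |
    J = -Jᴴ ∧ (R = Rᴴ ∧ R.PosSemidef) ∧ Eᴴ * Q = Qᴴ * E ∧ (Eᴴ * Q).PosSemidef}

open Matrix in
/-- Dissipative port-Hamiltonian systems. -/
def SigmaDH : Set (Quintuple 𝕜 ℓ n m) :=
  {(E, J, R, Q, _B) : Quintuple 𝕜 ℓ n m |
    J = -Jᴴ ∧ (R = Rᴴ ∧ R.PosDef) ∧ Eᴴ * Q = Qᴴ * E ∧ (Eᴴ * Q).PosSemidef}

/-! ### The rank conditions, for `[E, A, B]` with `E, A ∈ 𝕜^{ℓ × n}`, `B ∈ 𝕜^{ℓ × m}` -/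

variable {𝕜 ℓ n m}

/-- `rk [E, B] = min {ℓ, n + m}`. -/
def FullRankEB (E : Matrix (Fin ℓ) (Fin n) 𝕜) (B : Matrix (Fin ℓ) (Fin m) 𝕜) : Prop :=
  (Matrix.fromCols E B).rank = min ℓ (n + m)

/-- `rk [E, A, B] = min {ℓ, 2n + m}`. -/
def FullRankEAB (E A : Matrix (Fin ℓ) (Fin n) 𝕜) (B : Matrix (Fin ℓ) (Fin m) 𝕜) : Prop :=
  (Matrix.fromCols E (Matrix.fromCols A B)).rank = min ℓ (2 * n + m)

/-- `rk [xE - A, B] = min {ℓ, n + m}` over the field `𝕜(x)` of rational functions. -/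
def FullRankPencil (E A : Matrix (Fin ℓ) (Fin n) 𝕜) (B : Matrix (Fin ℓ) (Fin m) 𝕜) : Prop :=
  (Matrix.fromCols ((RatFunc.X : RatFunc 𝕜) • E.map RatFunc.C - A.map RatFunc.C)
    (B.map RatFunc.C)).rank = min ℓ (n + m)

/-- `rk [E, AZ, B] = min {ℓ, n + m}` for all `Z ∈ 𝕜^{n × (n - rk E)}` with `im Z = ker E`. -/
def FullRankKernel (E A : Matrix (Fin ℓ) (Fin n) 𝕜) (B : Matrix (Fin ℓ) (Fin m) 𝕜) : Prop :=
  ∀ Z : Matrix (Fin n) (Fin (n - E.rank)) 𝕜,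
    LinearMap.range Z.mulVecLin = LinearMap.ker E.mulVecLin →
      (Matrix.fromCols E (Matrix.fromCols (A * Z) B)).rank = min ℓ (n + m)

/-- `rk [λE - A, B] = min {ℓ, n + m}` over `ℂ` for all `λ ∈ ℂ`. Here `RCLike.map 𝕜 ℂ` is the
inclusion `ℝ ⊆ ℂ` if `𝕜 = ℝ`, and the identity if `𝕜 = ℂ`. -/
def FullRankPointwise (E A : Matrix (Fin ℓ) (Fin n) 𝕜) (B : Matrix (Fin ℓ) (Fin m) 𝕜) : Prop :=
  ∀ z : ℂ, (Matrix.fromCols (z • E.map (RCLike.map 𝕜 ℂ) - A.map (RCLike.map 𝕜 ℂ))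
    (B.map (RCLike.map 𝕜 ℂ))).rank = min ℓ (n + m)

variable (𝕜 ℓ n m)

/-! ### The subsets of the spaces of matrix quadruples and quintuples -/

def Sa : Set (Quadruple 𝕜 ℓ n m) :=
  {(E, _J, _Q, B) : Quadruple 𝕜 ℓ n m | FullRankEB E B}

def Sb : Set (Quadruple 𝕜 ℓ n m) :=
  {(E, J, Q, B) : Quadruple 𝕜 ℓ n m | FullRankEAB E (J * Q) B}

def Sc : Set (Quadruple 𝕜 ℓ n m) :=
  {(E, J, Q, B) : Quadruple 𝕜 ℓ n m | FullRankPencil E (J * Q) B}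

def Sd : Set (Quadruple 𝕜 ℓ n m) :=
  {(E, J, Q, B) : Quadruple 𝕜 ℓ n m | FullRankKernel E (J * Q) B}

def Se : Set (Quintuple 𝕜 ℓ n m) :=
  {(E, _J, _R, _Q, B) : Quintuple 𝕜 ℓ n m | FullRankEB E B}

def Sf : Set (Quintuple 𝕜 ℓ n m) :=
  {(E, J, R, Q, B) : Quintuple 𝕜 ℓ n m | FullRankEAB E ((J - R) * Q) B}

def Sg : Set (Quintuple 𝕜 ℓ n m) :=
  {(E, J, R, Q, B) : Quintuple 𝕜 ℓ n m | FullRankPencil E ((J - R) * Q) B}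

def Sh : Set (Quintuple 𝕜 ℓ n m) :=
  {(E, J, R, Q, B) : Quintuple 𝕜 ℓ n m | FullRankKernel E ((J - R) * Q) B}

def Si : Set (Quadruple 𝕜 ℓ n m) :=
  {(E, J, Q, B) : Quadruple 𝕜 ℓ n m | FullRankPointwise E (J * Q) B}

def Sj : Set (Quintuple 𝕜 ℓ n m) :=
  {(E, J, R, Q, B) : Quintuple 𝕜 ℓ n m | FullRankPointwise E ((J - R) * Q) B}

end PortHamiltonian

end

open scoped ComplexOrder

noncomputable section

namespace PortHamiltonian

/-! Each condition is implied by injectivity of a matrix `N` with real-polynomial dependence on the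
data, i.e. by nonvanishing of the real polynomial |det(Nᴴ N)|². Its zero set serves as the algebraic
set, so only density remains.

The constraint Eᴴ Q ≥ 0 is quadratic and the reference sets are not convex, so density is obtained
along curves. For t > 0 the pair (E + tQ, Q) still satisfies the constraint, and there Q = K(E + tQ)
with K ≥ 0 (`exists_posSemidef_eq_mul`). Conversely, every pair (F, KF) with K ≥ 0 is admissible.
Moving E + tQ to E₁, K to the identity, J to a skew J₁ and R to 0 along segments gives a quadratic
curve in the reference set that tends to (E₁, J₁, 0, E₁, B₁). A polynomial nonzero at this end is
nonzero for small positive parameters. Hence a single witness (E₁, J₁E₁, B₁) serves all three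
reference sets (`GenericOnSigma.of_injective`).

The witnesses are built from 0-1 matrices. Full rank of [E, B] gives (a), (e) and also forces (d),
(h); a shift J₁ gives (b), (f); evaluating the pencil at x = 1 with J₁ = 0 gives (c), (g). For (i),
(j) with ℓ ≠ n + m, a kernel vector v of the pencil at λ produces the chain v, λv, λ²v, … in the
kernel of a matrix free of λ, and that matrix is injective for a tridiagonal J₁. If ℓ = n + m and
[E, B] is invertible, an eigenvalue argument yields a rank drop, so the complement is generic, and
`IsRelGeneric.not_compl` rules out the set itself. -/

/-! ### Polynomial functions on real vector spaces -/

section PolyFun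

variable (W : Type*) [AddCommGroup W] [Module ℝ W] [Module.Finite ℝ W]

/-- Real polynomial functions on a finite-dimensional real vector space. -/
def realPolyFun : Subalgebra ℝ (W → ℝ) :=
  (MvPolynomial.aeval (R := ℝ) fun i (w : W) => (Module.finBasis ℝ W).equivFun w i).range

variable {W}

theorem mem_realPolyFun_iff {f : W → ℝ} :
    f ∈ realPolyFun W ↔ ∃ p : MvPolynomial (Fin (Module.finrank ℝ W)) ℝ,
      ∀ w, MvPolynomial.eval ((Module.finBasis ℝ W).equivFun w) p = f w := by
  have key : ∀ (p : MvPolynomial (Fin (Module.finrank ℝ W)) ℝ) (w : W),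
      MvPolynomial.aeval (R := ℝ) (fun i (w : W) => (Module.finBasis ℝ W).equivFun w i) p w =
        MvPolynomial.eval ((Module.finBasis ℝ W).equivFun w) p := by
    intro p w
    have := MvPolynomial.comp_aeval_apply (R := ℝ)
      (fun i (w : W) => (Module.finBasis ℝ W).equivFun w i) (Pi.evalAlgHom ℝ (fun _ : W => ℝ) w) p
    simpa [MvPolynomial.aeval_eq_eval] using this
  constructor
  · rintro ⟨p, rfl⟩
    exact ⟨p, fun w => (key p w).symm⟩
  · rintro ⟨p, hp⟩
    exact ⟨p, funext fun w => (key p w).trans (hp w)⟩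

theorem linear_mem_realPolyFun (g : W →ₗ[ℝ] ℝ) : (fun w => g w) ∈ realPolyFun W := by
  have h : (fun w => g w) = ∑ i, (g (Module.finBasis ℝ W i)) •
      (fun w : W => (Module.finBasis ℝ W).equivFun w i) := by
    ext w
    conv_lhs => rw [← (Module.finBasis ℝ W).sum_equivFun w]
    rw [map_sum]
    simp [Finset.sum_apply, mul_comm]
  rw [h]
  exact Subalgebra.sum_mem _ fun i _ => Subalgebra.smul_mem _
    (AlgHom.mem_range _ |>.2 ⟨MvPolynomial.X i, MvPolynomial.aeval_X _ i⟩) _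

variable (W) (𝕜 : Type*) [RCLike 𝕜]

/-- Functions with polynomial real and imaginary parts. -/
def polyFun : Subring (W → 𝕜) where
  carrier := {g | (fun w => RCLike.re (g w)) ∈ realPolyFun W ∧
    (fun w => RCLike.im (g w)) ∈ realPolyFun W}
  mul_mem' := by
    rintro f g ⟨hf, hf'⟩ ⟨hg, hg'⟩
    constructor
    · simp only [Pi.mul_apply, RCLike.mul_re]
      exact sub_mem (mul_mem hf hg) (mul_mem hf' hg')
    · simp only [Pi.mul_apply, RCLike.mul_im]
      exact add_mem (mul_mem hf hg') (mul_mem hf' hg)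
  one_mem' := by
    constructor
    · simp only [Pi.one_apply, RCLike.one_re]
      exact one_mem (realPolyFun W)
    · simp only [Pi.one_apply, RCLike.one_im]
      exact zero_mem (realPolyFun W)
  add_mem' := by
    rintro f g ⟨hf, hf'⟩ ⟨hg, hg'⟩
    constructor
    · simp only [Pi.add_apply, map_add]
      exact add_mem hf hg
    · simp only [Pi.add_apply, map_add]
      exact add_mem hf' hg'
  zero_mem' := by
    constructor <;> simp only [Pi.zero_apply, map_zero] <;> exact zero_mem (realPolyFun W)
  neg_mem' := by
    rintro f ⟨hf, hf'⟩
    constructor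
    · simp only [Pi.neg_apply, map_neg]
      exact neg_mem hf
    · simp only [Pi.neg_apply, map_neg]
      exact neg_mem hf'

variable {W 𝕜}

theorem const_mem_polyFun (c : 𝕜) : (fun _ => c) ∈ polyFun W 𝕜 :=
  ⟨(realPolyFun W).algebraMap_mem (RCLike.re c), (realPolyFun W).algebraMap_mem (RCLike.im c)⟩

/-- Polynomiality is taken over ℝ precisely so that conjugation is allowed, since conjugate
transposes enter the determinants. -/
theorem star_mem_polyFun {g : W → 𝕜} (hg : g ∈ polyFun W 𝕜) :
    (fun w => star (g w)) ∈ polyFun W 𝕜 := by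
  refine ⟨by simpa using hg.1, ?_⟩
  simp only [RCLike.star_def, RCLike.conj_im]
  exact neg_mem hg.2

theorem map_mem_polyFun {g : W → 𝕜} (hg : g ∈ polyFun W 𝕜) :
    (fun w => RCLike.map 𝕜 ℂ (g w)) ∈ polyFun W ℂ := by
  refine ⟨by simpa using hg.1, by simpa using hg.2⟩

theorem linear_mem_polyFun (g : W →ₗ[ℝ] 𝕜) : (fun w => g w) ∈ polyFun W 𝕜 :=
  ⟨linear_mem_realPolyFun (RCLike.reLm ∘ₗ g), linear_mem_realPolyFun (RCLike.imLm ∘ₗ g)⟩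

theorem normSq_mem_realPolyFun {g : W → 𝕜} (hg : g ∈ polyFun W 𝕜) :
    (fun w => RCLike.normSq (g w)) ∈ realPolyFun W := by
  simp only [RCLike.normSq_apply]
  exact add_mem (mul_mem hg.1 hg.1) (mul_mem hg.2 hg.2)

/-- Matrix-valued functions with polynomial entries. -/
def PolyMat {ι κ : Type*} (M : W → Matrix ι κ 𝕜) : Prop :=
  ∀ i j, (fun w => M w i j) ∈ polyFun W 𝕜

namespace PolyMat

variable {ι κ μ : Type*} {M N : W → Matrix ι κ 𝕜}

theorem sub (hM : PolyMat M) (hN : PolyMat N) : PolyMat fun w => M w - N w := fun i j =>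
  (polyFun W 𝕜).sub_mem (hM i j) (hN i j)

theorem transpose (hM : PolyMat M) : PolyMat fun w => (M w).transpose := fun i j => hM j i

theorem conjTranspose (hM : PolyMat M) : PolyMat fun w => (M w).conjTranspose := fun i j =>
  star_mem_polyFun (hM j i)

theorem map (hM : PolyMat M) : PolyMat fun w => (M w).map (RCLike.map 𝕜 ℂ) := fun i j =>
  map_mem_polyFun (hM i j)

theorem fromCols {N : W → Matrix ι μ 𝕜} (hM : PolyMat M) (hN : PolyMat N) :
    PolyMat fun w => Matrix.fromCols (M w) (N w) := by
  rintro i (j | j)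
  exacts [hM i j, hN i j]

theorem fromRows {N : W → Matrix μ κ 𝕜} (hM : PolyMat M) (hN : PolyMat N) :
    PolyMat fun w => Matrix.fromRows (M w) (N w) := by
  rintro (i | i) j
  exacts [hM i j, hN i j]

theorem mul [Fintype κ] {N : W → Matrix κ μ 𝕜} (hM : PolyMat M) (hN : PolyMat N) :
    PolyMat fun w => M w * N w := by
  intro i j
  have h : (fun w => (M w * N w) i j) = ∑ k, (fun w => M w i k) * fun w => N w k j := by
    ext w
    simp [Matrix.mul_apply]
  rw [h]
  exact (polyFun W 𝕜).sum_mem fun k _ => (polyFun W 𝕜).mul_mem (hM i k) (hN k j)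

theorem kronecker {ι' κ' : Type*} (C : Matrix ι' κ' 𝕜) (hM : PolyMat M) :
    PolyMat fun w => Matrix.kroneckerMap (· * ·) C (M w) := fun i j =>
  (polyFun W 𝕜).mul_mem (const_mem_polyFun (C i.1 j.1)) (hM i.2 j.2)

theorem det [Fintype ι] [DecidableEq ι] {M : W → Matrix ι ι 𝕜} (hM : PolyMat M) :
    (fun w => (M w).det) ∈ polyFun W 𝕜 := by
  have h : (fun w => (M w).det) = ∑ σ : Equiv.Perm ι,
      ((Equiv.Perm.sign σ : ℤ) : W → 𝕜) * ∏ i, fun w => M w (σ i) i := by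
    ext w
    simp [Matrix.det_apply', Finset.sum_apply, Finset.prod_apply]
  rw [h]
  exact (polyFun W 𝕜).sum_mem fun σ _ => (polyFun W 𝕜).mul_mem (intCast_mem (polyFun W 𝕜) _)
    ((polyFun W 𝕜).prod_mem fun i _ => hM (σ i) i)

theorem of_isLinearMap (h : IsLinearMap ℝ M) : PolyMat M := fun i j =>
  linear_mem_polyFun ((Matrix.entryLinearMap ℝ 𝕜 i j) ∘ₗ h.mk' M)

end PolyMat

end PolyFun

/-! ### Criteria for relative genericity -/

section Criteria

open Filter Topology

variable {W : Type*} [AddCommGroup W] [Module ℝ W] [Module.Finite ℝ W]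

theorem mem_closure_of_curve {d : ℕ} {x b c : Fin d → ℝ} {T : Set (Fin d → ℝ)}
    (h : ∀ᶠ t : ℝ in 𝓝[>] 0, x + t • b + t ^ 2 • c ∈ T) : x ∈ closure T := by
  have hc : Tendsto (fun t : ℝ => x + t • b + t ^ 2 • c) (𝓝[>] 0) (𝓝 x) := by
    have : ContinuousAt (fun t : ℝ => x + t • b + t ^ 2 • c) 0 := by fun_prop
    have h2 := this.tendsto
    simp only [zero_smul, add_zero, ne_eq, OfNat.ofNat_ne_zero, not_false_eq_true, zero_pow] at h2
    exact h2.mono_left nhdsWithin_le_nhds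
  exact mem_closure_of_tendsto hc h

/-- A polynomial function that does not vanish at the parameter `1` of a quadratic curve does not
vanish at small positive parameters. -/
theorem eventually_ne_zero_of_curve {f : W → ℝ} (hf : f ∈ realPolyFun W) {x b c : W}
    (h : f (x + b + c) ≠ 0) : ∀ᶠ t : ℝ in 𝓝[>] 0, f (x + t • b + t ^ 2 • c) ≠ 0 := by
  obtain ⟨p, hp⟩ := mem_realPolyFun_iff.1 hf
  let e := (Module.finBasis ℝ W).equivFun
  let q : Polynomial ℝ := MvPolynomial.aeval (fun i => Polynomial.C (e x i) +
    Polynomial.X * Polynomial.C (e b i) + Polynomial.X ^ 2 * Polynomial.C (e c i)) p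
  have hq : ∀ t : ℝ, q.eval t = f (x + t • b + t ^ 2 • c) := by
    intro t
    have := MvPolynomial.comp_aeval_apply (R := ℝ) (fun i => Polynomial.C (e x i) +
      Polynomial.X * Polynomial.C (e b i) + Polynomial.X ^ 2 * Polynomial.C (e c i))
      (Polynomial.aeval t) p
    rw [← hp]
    simp only [Polynomial.coe_aeval_eq_eval, MvPolynomial.aeval_eq_eval] at this
    refine this.trans ?_
    congr 2
    ext i
    simp [e]
    ring
  -- `q` is `f` along the curve. Being nonzero at 1, it has finitely many roots, so a punctured
  -- neighbourhood of 0 contains none.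
  have hq0 : q ≠ 0 := by
    intro h0
    have := hq 1
    simp [h0] at this
    exact h this.symm
  have hfin : ∀ᶠ t : ℝ in 𝓝[≠] 0, q.eval t ≠ 0 := by
    have hF := (Polynomial.finite_setOfPred_isRoot hq0).subset (Set.sdiff_subset (t := {0}))
    filter_upwards [nhdsWithin_le_nhds (hF.isClosed.isOpen_compl.mem_nhds (by simp)),
      self_mem_nhdsWithin] with t ht ht0 hroot
    exact ht ⟨hroot, ht0⟩
  filter_upwards [hfin.filter_mono (nhdsWithin_mono _ fun t ht => ne_of_gt ht)] with t ht
  rwa [← hq]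

/-- Relative genericity from a polynomial function vanishing on the exceptional set, when every
point of `V` can be moved along a line, and then along a quadratic curve, to a point where this
function does not vanish. -/
theorem IsRelGeneric.of_realPolyFun {S V : Set W} {f : W → ℝ} (hf : f ∈ realPolyFun W)
    (hS : ∀ v ∈ V, f v ≠ 0 → v ∈ S)
    (hV : ∀ v ∈ V, ∃ a : W, ∀ t : ℝ, 0 < t → ∃ b c : W, f (v + t • a + b + c) ≠ 0 ∧
      ∀ s : ℝ, 0 < s → s < 1 → v + t • a + s • b + s ^ 2 • c ∈ V) :
    IsRelGeneric S V := by
  obtain ⟨p, hp⟩ := mem_realPolyFun_iff.1 hf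
  let e := (Module.finBasis ℝ W).equivFun
  refine ⟨{x | ∀ q ∈ ({p} : Finset _), MvPolynomial.eval x q = 0}, ⟨{p}, rfl⟩, ?_, ?_⟩
  · rintro _ ⟨hx, v, hv, rfl⟩
    refine ⟨?_, v, hv, rfl⟩
    simp only [Finset.mem_singleton, forall_eq, Set.mem_ofPred_eq, hp]
    by_contra hne
    exact hx ⟨v, hS v hv hne, rfl⟩
  · rintro _ ⟨v, hv, rfl⟩
    obtain ⟨a, ha⟩ := hV v hv
    -- Two successive limits: `v + t • a` tends to `v`, and each `v + t • a` is a limit of points of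
    -- `V` off the zero set.
    rw [← closure_closure]
    refine mem_closure_of_curve (b := e a) (c := 0) ?_
    filter_upwards [self_mem_nhdsWithin] with t ht
    obtain ⟨b, c, hne, hmem⟩ := ha t ht
    have h1 := eventually_ne_zero_of_curve hf hne
    refine mem_closure_of_curve (b := e b) (c := e c) ?_
    filter_upwards [h1, self_mem_nhdsWithin,
      nhdsWithin_le_nhds (Iio_mem_nhds (zero_lt_one (α := ℝ)))] with s hs hs0 hs1
    have heq : e v + t • e a + t ^ 2 • (0 : Fin _ → ℝ) + s • e b + s ^ 2 • e c =
        e (v + t • a + s • b + s ^ 2 • c) := by simp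
    change e v + t • e a + t ^ 2 • (0 : Fin _ → ℝ) + s • e b + s ^ 2 • e c ∈ _
    rw [heq]
    refine ⟨?_, _, hmem s hs0 hs1, rfl⟩
    simp only [Finset.mem_singleton, forall_eq, Set.mem_compl_iff, Set.mem_ofPred_eq]
    rwa [hp]

theorem IsAlgebraicSet.isClosed {d : ℕ} {A : Set (Fin d → ℝ)} (hA : IsAlgebraicSet A) :
    IsClosed A := by
  obtain ⟨s, rfl⟩ := hA
  simp only [Set.ofPred_forall]
  exact isClosed_iInter fun p => isClosed_iInter fun _ =>
    isClosed_eq (MvPolynomial.continuous_eval p) continuous_const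

/-- A set and its complement are not both relative generic in a nonempty set. -/
theorem IsRelGeneric.not_compl {S V : Set W} (hV : V.Nonempty) (h : IsRelGeneric S V) :
    ¬ IsRelGeneric Sᶜ V := by
  rintro ⟨A₂, hA₂, hS₂, hd₂⟩
  obtain ⟨A₁, hA₁, hS₁, hd₁⟩ := h
  obtain ⟨v, hv⟩ := hV
  have h₁ := hd₁ ⟨v, hv, rfl⟩
  obtain ⟨y, -, hy₁, hyV⟩ := mem_closure_iff.1 h₁ _ isOpen_univ trivial
  -- Since `A₁ᶜ` is open, density of `A₂ᶜ` near `y` gives a point of `V` outside both algebraic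
  -- sets.
  obtain ⟨z, hz₁, hz₂, u, hu, rfl⟩ := mem_closure_iff.1 (hd₂ hyV) _ hA₁.isClosed.isOpen_compl hy₁
  by_cases hus : u ∈ S
  · refine hz₂ (hS₂ ⟨?_, u, hu, rfl⟩).1
    rintro ⟨u', hu', he⟩
    exact hu' ((Module.finBasis ℝ W).equivFun.injective he ▸ hus)
  · refine hz₁ (hS₁ ⟨?_, u, hu, rfl⟩).1
    rintro ⟨u', hu', he⟩
    exact hus ((Module.finBasis ℝ W).equivFun.injective he ▸ hu')

open Matrix in
theorem det_conjTranspose_mul_self_ne_zero_iff {𝕜 ι κ : Type*} [RCLike 𝕜] [Fintype ι] [Fintype κ]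
    [DecidableEq κ] (M : Matrix ι κ 𝕜) :
    (Mᴴ * M).det ≠ 0 ↔ Function.Injective M.mulVec := by
  constructor
  · intro h
    have hu := Matrix.mulVec_injective_of_isUnit ((Matrix.isUnit_iff_isUnit_det _).2 h.isUnit)
    intro x y hxy
    apply hu
    simp only [← Matrix.mulVec_mulVec, hxy]
  · intro h
    exact (PosDef.conjTranspose_mul_self M h).det_pos.ne'

/-- Relative genericity from a matrix with polynomial entries that is injective only on the
given set. -/
theorem IsRelGeneric.of_polyMat {𝕜 ι κ : Type*} [RCLike 𝕜] [Fintype ι] [Fintype κ]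
    {S V : Set W} {M : W → Matrix ι κ 𝕜} (hM : PolyMat M)
    (hS : ∀ v ∈ V, Function.Injective (M v).mulVec → v ∈ S)
    (hV : ∀ v ∈ V, ∃ a : W, ∀ t : ℝ, 0 < t → ∃ b c : W,
      Function.Injective (M (v + t • a + b + c)).mulVec ∧
      ∀ s : ℝ, 0 < s → s < 1 → v + t • a + s • b + s ^ 2 • c ∈ V) :
    IsRelGeneric S V := by
  classical
  have key : ∀ w, RCLike.normSq ((M w).conjTranspose * M w).det ≠ 0 ↔
      Function.Injective (M w).mulVec := fun w => by
    rw [← det_conjTranspose_mul_self_ne_zero_iff, ne_eq, map_eq_zero]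
  refine IsRelGeneric.of_realPolyFun (normSq_mem_realPolyFun (hM.conjTranspose.mul hM).det) ?_ ?_
  · simpa only [key] using hS
  · simpa only [key] using hV

end Criteria

/-! ### Parametrization of the reference sets -/

section Parametrization

open Matrix

variable {𝕜 : Type*} [RCLike 𝕜]

/-- Positive semidefinite matrices have positive semidefinite generalized inverses. -/
theorem exists_posSemidef_generalized_inverse {κ : Type*} [Fintype κ] [DecidableEq κ]
    {M : Matrix κ κ 𝕜} (hM : M.PosSemidef) : ∃ G : Matrix κ κ 𝕜, G.PosSemidef ∧ M * G * M = M := by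
  let U : Matrix κ κ 𝕜 := hM.isHermitian.eigenvectorUnitary
  let μ := hM.isHermitian.eigenvalues
  let D : Matrix κ κ 𝕜 := diagonal (RCLike.ofReal ∘ μ)
  -- With 0⁻¹ = 0 the zero eigenvalues need no separate treatment.
  let D' : Matrix κ κ 𝕜 := diagonal (RCLike.ofReal ∘ fun i => (μ i)⁻¹)
  have hU : Uᴴ * U = 1 := Unitary.coe_star_mul_self hM.isHermitian.eigenvectorUnitary
  have hMU : M = U * D * Uᴴ := by
    have := hM.isHermitian.spectral_theorem
    rwa [Unitary.conjStarAlgAut_apply] at this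
  have hD : D * D' * D = D := by
    simp only [D, D', diagonal_mul_diagonal, Function.comp_apply]
    congr 1
    ext i
    simp only [Function.comp_apply, ← RCLike.ofReal_mul, mul_inv_mul_cancel]
  refine ⟨U * D' * Uᴴ, ?_, ?_⟩
  · refine PosSemidef.mul_mul_conjTranspose_same (PosSemidef.diagonal fun i => ?_) U
    simpa using hM.eigenvalues_nonneg i
  · calc M * (U * D' * Uᴴ) * M = U * (D * (Uᴴ * U) * D' * (Uᴴ * U) * D) * Uᴴ := by
          rw [hMU]; simp only [Matrix.mul_assoc]
      _ = M := by rw [hU, Matrix.mul_one, Matrix.mul_one, hD, ← hMU]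

/-- If `Eᴴ * Q` is positive semidefinite, then `Q = K * (E + t • Q)` for a positive semidefinite
matrix `K`. -/
theorem exists_posSemidef_eq_mul {ι κ : Type*} [Fintype ι] [Fintype κ]
    {E Q : Matrix ι κ 𝕜} (h : (Eᴴ * Q).PosSemidef) {t : ℝ} (ht : 0 < t) :
    ∃ K : Matrix ι ι 𝕜, K.PosSemidef ∧ Q = K * (E + t • Q) := by
  classical
  have ht' : (0 : 𝕜) ≤ (t : 𝕜) := by exact_mod_cast ht.le
  have hsm : t • Q = (t : 𝕜) • Q := by ext i j; simp [RCLike.real_smul_eq_coe_mul]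
  let M : Matrix κ κ 𝕜 := Eᴴ * Q + (t : 𝕜) • (Qᴴ * Q)
  have hM : M.PosSemidef := h.add ((posSemidef_conjTranspose_mul_self Q).smul ht')
  -- The form of `M` is a sum of two nonnegative terms, the second being t‖Qx‖²; this is where t > 0
  -- is essential.
  have hker : ∀ x, M *ᵥ x = 0 → Q *ᵥ x = 0 := by
    intro x hx
    have h1 := h.dotProduct_mulVec_nonneg x
    have h2 := (posSemidef_conjTranspose_mul_self Q).dotProduct_mulVec_nonneg x
    have h3 : star x ⬝ᵥ ((Eᴴ * Q) *ᵥ x) + (t : 𝕜) * (star x ⬝ᵥ ((Qᴴ * Q) *ᵥ x)) = 0 := by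
      rw [← smul_eq_mul, ← dotProduct_smul, ← smul_mulVec, ← dotProduct_add, ← add_mulVec, hx,
        dotProduct_zero]
    have h4 := (add_eq_zero_iff_of_nonneg h1 (mul_nonneg ht' h2)).1 h3
    have h5 : star x ⬝ᵥ ((Qᴴ * Q) *ᵥ x) = 0 := by
      rcases mul_eq_zero.1 h4.2 with h6 | h6
      · exact absurd (by exact_mod_cast h6) ht.ne'
      · exact h6
    rw [← mulVec_mulVec, dotProduct_mulVec, ← star_mulVec] at h5
    exact dotProduct_star_self_eq_zero.1 h5
  obtain ⟨G, hG, hMG⟩ := exists_posSemidef_generalized_inverse hM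
  -- Since Qᴴ(E + tQ) = M, the claim becomes Q G M = Q; it holds because the columns of G M - 1 lie
  -- in ker M ⊆ ker Q.
  refine ⟨Q * G * Qᴴ, hG.mul_mul_conjTranspose_same Q, ?_⟩
  have hME : Qᴴ * (E + t • Q) = M := by
    have := h.isHermitian.eq
    rw [conjTranspose_mul, conjTranspose_conjTranspose] at this
    rw [Matrix.mul_add, this, hsm, Matrix.mul_smul]
  rw [Matrix.mul_assoc, hME]
  have hz : Q * (G * M - 1) = 0 := by
    ext i j
    have : M * (G * M - 1) = 0 := by
      rw [Matrix.mul_sub, ← Matrix.mul_assoc, hMG, Matrix.mul_one, sub_self]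
    have hcol : M *ᵥ (fun k => (G * M - 1) k j) = 0 := by
      ext k
      exact congrFun (congrFun this k) j
    exact congrFun (hker _ hcol) i
  rw [Matrix.mul_sub, Matrix.mul_one, sub_eq_zero] at hz
  rw [Matrix.mul_assoc, hz]

theorem posSemidef_segment {κ : Type*} [Fintype κ] {K L : Matrix κ κ 𝕜} (hK : K.PosSemidef)
    (hL : L.PosSemidef) {s : ℝ} (hs₀ : 0 < s) (hs₁ : s < 1) : (K + s • (L - K)).PosSemidef := by
  have h : K + s • (L - K) = ((1 - s : ℝ) : 𝕜) • K + (s : 𝕜) • L := by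
    ext i j
    simp [RCLike.real_smul_eq_coe_mul]
    ring
  rw [h]
  refine (hK.smul ?_).add (hL.smul ?_)
  · exact_mod_cast (sub_pos.2 hs₁).le
  · exact_mod_cast hs₀.le

theorem posSemidef_shrink {κ : Type*} [Fintype κ] {R : Matrix κ κ 𝕜} (hR : R.PosSemidef)
    {s : ℝ} (hs₀ : 0 < s) (hs₁ : s < 1) : (R + s • -R).PosSemidef := by
  simpa using posSemidef_segment hR PosSemidef.zero hs₀ hs₁

theorem posDef_shrink {κ : Type*} [Fintype κ] {R : Matrix κ κ 𝕜} (hR : R.PosDef)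
    {s : ℝ} (hs₁ : s < 1) : (R + s • -R).PosDef := by
  have h : R + s • -R = ((1 - s : ℝ) : 𝕜) • R := by
    ext i j
    simp [RCLike.real_smul_eq_coe_mul]
    ring
  rw [h]
  exact hR.smul (by exact_mod_cast sub_pos.2 hs₁)

theorem skew_segment {κ : Type*} {J L : Matrix κ κ 𝕜} (hJ : J = -Jᴴ) (hL : L = -Lᴴ) (s : ℝ) :
    J + s • (L - J) = -(J + s • (L - J))ᴴ := by
  rw [conjTranspose_add, conjTranspose_smul, conjTranspose_sub]
  nth_rewrite 1 [hJ]
  nth_rewrite 1 [hL]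
  nth_rewrite 2 [hJ]
  simp only [star_trivial]
  module

/-- The product of two segments is a quadratic curve; its coefficients are the Q-components of the
directions used in `GenericOnSigma.of_injective`. -/
theorem mul_segment {ι κ : Type*} [Fintype ι] [DecidableEq ι] (K : Matrix ι ι 𝕜)
    (E F : Matrix ι κ 𝕜) (s : ℝ) :
    K * E + s • (K * (F - E) + (1 - K) * E) + s ^ 2 • ((1 - K) * (F - E)) =
      (K + s • (1 - K)) * (E + s • (F - E)) := by
  simp only [Matrix.add_mul, Matrix.mul_add, Matrix.smul_mul, Matrix.mul_smul, smul_smul, pow_two,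
    smul_add]
  abel

theorem conjTranspose_mul_mul_symm {ι κ : Type*} [Fintype ι] [Fintype κ] {K : Matrix ι ι 𝕜}
    (hK : K.PosSemidef) (E : Matrix ι κ 𝕜) :
    Eᴴ * (K * E) = (K * E)ᴴ * E ∧ (Eᴴ * (K * E)).PosSemidef := by
  constructor
  · rw [conjTranspose_mul, hK.isHermitian.eq, Matrix.mul_assoc]
  · rw [← Matrix.mul_assoc]
    exact hK.conjTranspose_mul_mul_same E

end Parametrization

/-! ### Genericity of conditions on `(E, A, B)` in the reference sets -/

section Generic

universe u

variable {𝕜 : Type u} [RCLike 𝕜] {ℓ n m : ℕ}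

/-- The condition `P E A B`, with `A = J * Q` or `A = (J - R) * Q`, holds generically in each of
the three reference sets. -/
def GenericOnSigma (P : Matrix (Fin ℓ) (Fin n) 𝕜 → Matrix (Fin ℓ) (Fin n) 𝕜 →
    Matrix (Fin ℓ) (Fin m) 𝕜 → Prop) : Prop :=
  IsRelGeneric {(E, J, Q, B) : Quadruple 𝕜 ℓ n m | P E (J * Q) B} (SigmaH 𝕜 ℓ n m) ∧
    ∀ V ∈ ({SigmaSdH 𝕜 ℓ n m, SigmaDH 𝕜 ℓ n m} : Set (Set (Quintuple 𝕜 ℓ n m))),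
      IsRelGeneric {(E, J, R, Q, B) : Quintuple 𝕜 ℓ n m | P E ((J - R) * Q) B} V

/-- A matrix-valued function of `(E, A, B)` that preserves polynomial dependence. -/
def PreservesPoly {𝕜' : Type*} [RCLike 𝕜'] {ι κ : Type*}
    (N : Matrix (Fin ℓ) (Fin n) 𝕜 → Matrix (Fin ℓ) (Fin n) 𝕜 →
      Matrix (Fin ℓ) (Fin m) 𝕜 → Matrix ι κ 𝕜') : Prop :=
  ∀ (W : Type u) [AddCommGroup W] [Module ℝ W] [Module.Finite ℝ W]
    (E A : W → Matrix (Fin ℓ) (Fin n) 𝕜) (B : W → Matrix (Fin ℓ) (Fin m) 𝕜),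
    PolyMat E → PolyMat A → PolyMat B → PolyMat fun w => N (E w) (A w) (B w)

theorem GenericOnSigma.mono {P P' : Matrix (Fin ℓ) (Fin n) 𝕜 → Matrix (Fin ℓ) (Fin n) 𝕜 →
    Matrix (Fin ℓ) (Fin m) 𝕜 → Prop} (h : ∀ E A B, P E A B → P' E A B) (hP : GenericOnSigma P) :
    GenericOnSigma P' := by
  have key : ∀ {W : Type u} [AddCommGroup W] [Module ℝ W] [Module.Finite ℝ W] {S S' V : Set W},
      S ⊆ S' → IsRelGeneric S V → IsRelGeneric S' V := by
    rintro W _ _ _ S S' V hS ⟨A, hA, hSA, hV⟩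
    refine ⟨A, hA, fun x hx => hSA ⟨fun hxS => hx.1 (Set.image_mono hS hxS), hx.2⟩, hV⟩
  exact ⟨key (fun _ => h _ _ _) hP.1, fun V hV => key (fun _ => h _ _ _) (hP.2 V hV)⟩

open Matrix in
/-- A condition implied by the injectivity of a matrix depending polynomially on `(E, A, B)` is
generic as soon as this matrix is injective at one point `(E, J * E, B)` with `J`
skew-Hermitian. -/
theorem GenericOnSigma.of_injective {𝕜' : Type*} [RCLike 𝕜'] {ι κ : Type*} [Fintype ι] [Fintype κ]
    {P : Matrix (Fin ℓ) (Fin n) 𝕜 → Matrix (Fin ℓ) (Fin n) 𝕜 →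
      Matrix (Fin ℓ) (Fin m) 𝕜 → Prop}
    {N : Matrix (Fin ℓ) (Fin n) 𝕜 → Matrix (Fin ℓ) (Fin n) 𝕜 →
      Matrix (Fin ℓ) (Fin m) 𝕜 → Matrix ι κ 𝕜'} (hN : PreservesPoly N)
    (hP : ∀ E A B, Function.Injective (N E A B).mulVec → P E A B)
    {E₁ : Matrix (Fin ℓ) (Fin n) 𝕜} {J₁ : Matrix (Fin ℓ) (Fin ℓ) 𝕜}
    {B₁ : Matrix (Fin ℓ) (Fin m) 𝕜} (hJ₁ : J₁ = -J₁ᴴ)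
    (h₁ : Function.Injective (N E₁ (J₁ * E₁) B₁).mulVec) : GenericOnSigma P := by
  constructor
  · refine IsRelGeneric.of_polyMat
      (M := fun w : Quadruple 𝕜 ℓ n m => N w.1 (w.2.1 * w.2.2.1) w.2.2.2) ?_
      (fun v _ h => hP _ _ _ h) ?_
    · exact hN _ _ _ _ (.of_isLinearMap ⟨fun _ _ => rfl, fun _ _ => rfl⟩)
        (.mul (.of_isLinearMap ⟨fun _ _ => rfl, fun _ _ => rfl⟩)
          (.of_isLinearMap ⟨fun _ _ => rfl, fun _ _ => rfl⟩))
        (.of_isLinearMap ⟨fun _ _ => rfl, fun _ _ => rfl⟩)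
    · rintro ⟨E, J, Q, B⟩ ⟨hJ, -, hEQ⟩
      refine ⟨(Q, 0, 0, 0), fun t ht => ?_⟩
      obtain ⟨K, hK, hQ⟩ := exists_posSemidef_eq_mul hEQ ht
      -- First and second order coefficients of the curve with E_s = (1 - s)(E + tQ) + sE₁, K_s = (1
      -- - s)K + s and Q_s = K_s E_s. At s = 1 both E and Q equal E₁.
      refine ⟨(E₁ - (E + t • Q), J₁ - J, K * (E₁ - (E + t • Q)) + (1 - K) * (E + t • Q), B₁ - B),
        (0, 0, (1 - K) * (E₁ - (E + t • Q)), 0), ?_, fun s hs₀ hs₁ => ?_⟩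
      · convert h₁ using 2
        have := mul_segment K (E + t • Q) E₁ 1
        rw [← hQ] at this
        simp only [one_smul, one_pow, add_sub_cancel, Matrix.one_mul] at this
        simp [this]
      · have := mul_segment K (E + t • Q) E₁ s
        rw [← hQ] at this
        simp only [Prod.smul_mk, Prod.mk_add_mk, smul_zero, add_zero]
        rw [this]
        exact ⟨skew_segment hJ hJ₁ s,
          conjTranspose_mul_mul_symm (posSemidef_segment hK PosSemidef.one hs₀ hs₁) _⟩
  · intro V hV
    refine IsRelGeneric.of_polyMat
      (M := fun w : Quintuple 𝕜 ℓ n m => N w.1 ((w.2.1 - w.2.2.1) * w.2.2.2.1) w.2.2.2.2) ?_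
      (fun v _ h => hP _ _ _ h) ?_
    · exact hN _ _ _ _ (.of_isLinearMap ⟨fun _ _ => rfl, fun _ _ => rfl⟩)
        (.mul (.sub (.of_isLinearMap ⟨fun _ _ => rfl, fun _ _ => rfl⟩)
          (.of_isLinearMap ⟨fun _ _ => rfl, fun _ _ => rfl⟩))
          (.of_isLinearMap ⟨fun _ _ => rfl, fun _ _ => rfl⟩))
        (.of_isLinearMap ⟨fun _ _ => rfl, fun _ _ => rfl⟩)
    · rintro ⟨E, J, R, Q, B⟩ hv
      obtain ⟨hJ, hEQ⟩ : J = -Jᴴ ∧ (Eᴴ * Q).PosSemidef := by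
        rcases hV with rfl | rfl
        exacts [⟨hv.1, hv.2.2.2⟩, ⟨hv.1, hv.2.2.2⟩]
      refine ⟨(Q, 0, 0, 0, 0), fun t ht => ?_⟩
      obtain ⟨K, hK, hQ⟩ := exists_posSemidef_eq_mul hEQ ht
      refine ⟨(E₁ - (E + t • Q), J₁ - J, -R,
        K * (E₁ - (E + t • Q)) + (1 - K) * (E + t • Q), B₁ - B),
        (0, 0, 0, (1 - K) * (E₁ - (E + t • Q)), 0), ?_, fun s hs₀ hs₁ => ?_⟩
      · convert h₁ using 2
        have := mul_segment K (E + t • Q) E₁ 1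
        rw [← hQ] at this
        simp only [one_smul, one_pow, add_sub_cancel, Matrix.one_mul] at this
        simp [this]
      · have := mul_segment K (E + t • Q) E₁ s
        rw [← hQ] at this
        simp only [Prod.smul_mk, Prod.mk_add_mk, smul_zero, add_zero]
        rw [this]
        have hE := conjTranspose_mul_mul_symm (posSemidef_segment hK PosSemidef.one hs₀ hs₁)
          (E + t • Q + s • (E₁ - (E + t • Q)))
        rcases hV with rfl | rfl
        · have hR := posSemidef_shrink hv.2.1.2 hs₀ hs₁
          exact ⟨skew_segment hJ hJ₁ s, ⟨hR.isHermitian.eq.symm, hR⟩, hE⟩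
        -- The end point R = 0 lies outside the positive definite matrices in general, but
        -- membership is needed only for 0 < s < 1.
        · have hR := posDef_shrink hv.2.1.2 hs₁
          exact ⟨skew_segment hJ hJ₁ s, ⟨hR.isHermitian.eq.symm, hR⟩, hE⟩

end Generic

/-! ### Matrices of full rank -/

section FullRank

open Matrix

theorem mulVec_injective_iff_ker {F ι κ : Type*} [Field F] [Fintype κ] {M : Matrix ι κ F} :
    Function.Injective M.mulVec ↔ ∀ x, M *ᵥ x = 0 → x = 0 :=
  injective_iff_map_eq_zero M.mulVecLin

theorem rank_of_mulVec_injective {F ι κ : Type*} [Field F] [Fintype κ]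
    {M : Matrix ι κ F} (h : Function.Injective M.mulVec) : M.rank = Fintype.card κ := by
  rw [Matrix.rank, LinearMap.finrank_range_of_inj (f := M.mulVecLin) h,
    Module.finrank_fintype_fun_eq_card]

/-- The columns or the rows of `M` are linearly independent. -/
def HasFullRank {F ι κ : Type*} [Field F] [Fintype ι] [Fintype κ] (M : Matrix ι κ F) : Prop :=
  Function.Injective M.mulVec ∨ Function.Injective Mᵀ.mulVec

theorem HasFullRank.rank_eq {F ι κ : Type*} [Field F] [Fintype ι] [Fintype κ] {M : Matrix ι κ F}
    (h : HasFullRank M) : M.rank = min (Fintype.card ι) (Fintype.card κ) := by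
  rcases h with h | h
  · have h1 := rank_of_mulVec_injective h
    have h2 := M.rank_le_card_height
    omega
  · have h1 := rank_of_mulVec_injective h
    rw [rank_transpose] at h1
    have h2 := M.rank_le_card_width
    omega

/-- Version of `GenericOnSigma.of_injective` for matrices of full row or column rank. -/
theorem GenericOnSigma.of_hasFullRank {𝕜 𝕜' : Type*} [RCLike 𝕜] [RCLike 𝕜'] {ℓ n m : ℕ}
    {ι κ : Type*} [Fintype ι] [Fintype κ]
    {P : Matrix (Fin ℓ) (Fin n) 𝕜 → Matrix (Fin ℓ) (Fin n) 𝕜 →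
      Matrix (Fin ℓ) (Fin m) 𝕜 → Prop}
    {N : Matrix (Fin ℓ) (Fin n) 𝕜 → Matrix (Fin ℓ) (Fin n) 𝕜 →
      Matrix (Fin ℓ) (Fin m) 𝕜 → Matrix ι κ 𝕜'} (hN : PreservesPoly N)
    (hP : ∀ E A B, HasFullRank (N E A B) → P E A B)
    {E₁ : Matrix (Fin ℓ) (Fin n) 𝕜} {J₁ : Matrix (Fin ℓ) (Fin ℓ) 𝕜}
    {B₁ : Matrix (Fin ℓ) (Fin m) 𝕜} (hJ₁ : J₁ = -J₁ᴴ)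
    (h₁ : HasFullRank (N E₁ (J₁ * E₁) B₁)) : GenericOnSigma P := by
  rcases h₁ with h₁ | h₁
  · exact .of_injective hN (fun E A B h => hP E A B (.inl h)) hJ₁ h₁
  · exact .of_injective (N := fun E A B => (N E A B)ᵀ)
      (fun W _ _ _ E A B hE hA hB => (hN W E A B hE hA hB).transpose)
      (fun E A B h => hP E A B (.inr h)) hJ₁ h₁

/-! ### Matrices of unit columns and their ranks. -/

/-- The `0`-`1` matrix whose column `c` is the unit vector with index `g c` (zero if there is no
such unit vector). -/
def unitCols (F : Type*) [Field F] (ℓ : ℕ) {κ : Type*} (g : κ → ℕ) : Matrix (Fin ℓ) κ F :=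
  of fun i c => if (i : ℕ) = g c then 1 else 0

/-- Extension of a finite vector to the natural numbers by zero. -/
def extendZero {F : Type*} [Field F] {ℓ : ℕ} (v : Fin ℓ → F) (a : ℕ) : F :=
  if h : a < ℓ then v ⟨a, h⟩ else 0

section

variable {F : Type*} [Field F] {ℓ : ℕ}

theorem extendZero_val (v : Fin ℓ → F) (i : Fin ℓ) : extendZero v i = v i := by
  simp [extendZero]

theorem extendZero_of_le (v : Fin ℓ → F) {a : ℕ} (h : ℓ ≤ a) : extendZero v a = 0 := by
  simp [extendZero, h]

theorem sum_ite_val_eq (v : Fin ℓ → F) (a : ℕ) :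
    ∑ i : Fin ℓ, (if (i : ℕ) = a then 1 else 0) * v i = extendZero v a := by
  unfold extendZero
  split_ifs with h
  · rw [Finset.sum_eq_single ⟨a, h⟩]
    · simp
    · intro b _ hb
      rw [if_neg (fun h => hb (Fin.ext h)), zero_mul]
    · simp
  · refine Finset.sum_eq_zero fun i _ => ?_
    rw [if_neg (by omega), zero_mul]

theorem sum_ite_val_add_one_eq (v : Fin ℓ → F) (a : ℕ) :
    ∑ i : Fin ℓ, (if (i : ℕ) + 1 = a then 1 else 0) * v i =
      if 0 < a then extendZero v (a - 1) else 0 := by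
  split_ifs with h
  · rw [← sum_ite_val_eq]
    refine Finset.sum_congr rfl fun i _ => ?_
    congr 2
    simp only [eq_iff_iff]
    omega
  · refine Finset.sum_eq_zero fun i _ => ?_
    rw [if_neg (by omega), zero_mul]

theorem transpose_unitCols_mulVec {κ : Type*} (g : κ → ℕ) (v : Fin ℓ → F) (c : κ) :
    ((unitCols F ℓ g)ᵀ *ᵥ v) c = extendZero v (g c) :=
  sum_ite_val_eq v (g c)

theorem unitCols_mulVec {κ : Type*} [Fintype κ] {g : κ → ℕ} (hg : Function.Injective g)
    (x : κ → F) {c : κ} (hc : g c < ℓ) : (unitCols F ℓ g *ᵥ x) ⟨g c, hc⟩ = x c := by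
  simp only [mulVec, dotProduct, unitCols, of_apply]
  rw [Finset.sum_eq_single c]
  · simp
  · intro b _ hb
    rw [if_neg (fun h => hb (hg h.symm)), zero_mul]
  · simp

theorem unitCols_mulVec_eq_zero {κ : Type*} [Fintype κ] {g : κ → ℕ} (x : κ → F) {i : Fin ℓ}
    (hi : ∀ c, g c ≠ i) : (unitCols F ℓ g *ᵥ x) i = 0 :=
  Finset.sum_eq_zero fun c _ => by simp [unitCols, (hi c).symm]

theorem mul_unitCols_val {n : ℕ} {ι : Type*} (J : Matrix ι (Fin ℓ) F) (i : ι) (c : Fin n) :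
    (J * unitCols F ℓ (fun c : Fin n => (c : ℕ))) i c = extendZero (J i) c := by
  rw [← sum_ite_val_eq, mul_apply]
  exact Finset.sum_congr rfl fun j _ => mul_comm _ _

theorem fromCols_unitCols {κ κ' : Type*} (g : κ → ℕ) (h : κ' → ℕ) :
    fromCols (unitCols F ℓ g) (unitCols F ℓ h) = unitCols F ℓ (Sum.elim g h) := by
  ext i (c | c) <;> rfl

/-- `g` is a bijection onto an initial segment of ℕ. If it fits below `ℓ`, the columns are distinct
unit vectors; otherwise every row index is hit. -/
theorem hasFullRank_unitCols {κ : Type*} [Fintype κ] {g : κ → ℕ} (hg : Function.Injective g)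
    (hlt : ∀ c, g c < Fintype.card κ) (hsurj : ∀ i < Fintype.card κ, ∃ c, g c = i) :
    HasFullRank (unitCols F ℓ g) := by
  rcases le_total (Fintype.card κ) ℓ with h | h
  · refine .inl (mulVec_injective_iff_ker.2 fun x hx => ?_)
    ext c
    rw [← unitCols_mulVec hg x ((hlt c).trans_le h), hx]
    rfl
  · refine .inr (mulVec_injective_iff_ker.2 fun v hv => ?_)
    ext i
    obtain ⟨c, hc⟩ := hsurj i (i.2.trans_le h)
    rw [← extendZero_val v i, ← hc, ← transpose_unitCols_mulVec, hv]
    rfl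

theorem hasFullRank_fromCols_unitCols (n m : ℕ) :
    HasFullRank (fromCols (unitCols F ℓ fun c : Fin n => (c : ℕ))
      (unitCols F ℓ fun c : Fin m => n + c)) := by
  rw [fromCols_unitCols]
  refine hasFullRank_unitCols ?_ ?_ ?_
  · rintro (a | a) (b | b) h <;> simp at h ⊢ <;> omega
  · rintro (a | a) <;> simp; omega
  · intro i hi
    simp only [Fintype.card_sum, Fintype.card_fin] at hi
    rcases lt_or_ge i n with h | h
    · exact ⟨.inl ⟨i, h⟩, rfl⟩
    · exact ⟨.inr ⟨i - n, by omega⟩, by simp; omega⟩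

theorem hasFullRank_fromCols_fromCols_unitCols (n m : ℕ) :
    HasFullRank (fromCols (unitCols F ℓ fun c : Fin n => (c : ℕ))
      (fromCols (unitCols F ℓ fun c : Fin n => n + c)
        (unitCols F ℓ fun c : Fin m => 2 * n + c))) := by
  rw [fromCols_unitCols, fromCols_unitCols]
  refine hasFullRank_unitCols ?_ ?_ ?_
  · rintro (a | a | a) (b | b | b) h <;> simp at h ⊢ <;> omega
  · rintro (a | a | a) <;> simp <;> omega
  · intro i hi
    simp only [Fintype.card_sum, Fintype.card_fin] at hi
    rcases lt_or_ge i n with h | h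
    · exact ⟨.inl ⟨i, h⟩, rfl⟩
    rcases lt_or_ge i (2 * n) with h' | h'
    · exact ⟨.inr (.inl ⟨i - n, by omega⟩), by simp; omega⟩
    · exact ⟨.inr (.inr ⟨i - 2 * n, by omega⟩), by simp; omega⟩

end

end FullRank

/-! ### The rank conditions on constant matrices and on the pencil -/

section Constant

open Matrix

variable {𝕜 : Type*} [RCLike 𝕜] {ℓ n m : ℕ}

theorem genericOnSigma_hasFullRank_EB :
    GenericOnSigma fun (E : Matrix (Fin ℓ) (Fin n) 𝕜) (_ : Matrix (Fin ℓ) (Fin n) 𝕜)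
      (B : Matrix (Fin ℓ) (Fin m) 𝕜) => HasFullRank (fromCols E B) :=
  .of_hasFullRank (N := fun E _ B => fromCols E B) (fun _ _ _ _ _ _ _ hE _ hB => hE.fromCols hB)
    (fun _ _ _ h => h) (J₁ := 0) (by simp) (hasFullRank_fromCols_unitCols n m)

theorem fullRankEB_of_hasFullRank {E : Matrix (Fin ℓ) (Fin n) 𝕜} {B : Matrix (Fin ℓ) (Fin m) 𝕜}
    (h : HasFullRank (fromCols E B)) : FullRankEB E B := by
  simpa [FullRankEB] using h.rank_eq

/-- Full column rank of [E, B] makes ker E trivial, so Z has no columns; full row rank survives the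
insertion of further columns. -/
theorem fullRankKernel_of_hasFullRank {E A : Matrix (Fin ℓ) (Fin n) 𝕜}
    {B : Matrix (Fin ℓ) (Fin m) 𝕜} (h : HasFullRank (fromCols E B)) : FullRankKernel E A B := by
  intro Z _
  have hr := h.rank_eq
  simp only [Fintype.card_sum, Fintype.card_fin] at hr
  rcases h with h | h
  · have hEB := mulVec_injective_iff_ker.1 h
    have hE : E.rank = n := by
      rw [rank_of_mulVec_injective (M := E), Fintype.card_fin]
      refine mulVec_injective_iff_ker.2 fun x hx => ?_
      have := hEB (Sum.elim x 0) (by simp [fromCols_mulVec, hx])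
      exact funext fun i => congrFun this (.inl i)
    have h1 := rank_of_mulVec_injective h
    simp only [Fintype.card_sum, Fintype.card_fin] at h1
    rw [rank_of_mulVec_injective]
    · simp only [Fintype.card_sum, Fintype.card_fin]
      omega
    · refine mulVec_injective_iff_ker.2 fun x hx => ?_
      have hempty : IsEmpty (Fin (n - E.rank)) := by rw [hE, Nat.sub_self]; infer_instance
      rw [fromCols_mulVec, fromCols_mulVec] at hx
      have hz : (A * Z) *ᵥ ((x ∘ Sum.inr) ∘ Sum.inl) = 0 := by
        ext i
        simp [mulVec, dotProduct]
      rw [hz, zero_add] at hx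
      have := hEB (Sum.elim (x ∘ Sum.inl) ((x ∘ Sum.inr) ∘ Sum.inr)) (by
        simpa [fromCols_mulVec] using hx)
      ext (i | i | i)
      · exact congrFun this (.inl i)
      · exact hempty.elim i
      · exact congrFun this (.inr i)
  · have h1 := rank_of_mulVec_injective h
    rw [rank_transpose, Fintype.card_fin] at h1
    rw [← rank_transpose, rank_of_mulVec_injective, Fintype.card_fin]
    · omega
    · refine mulVec_injective_iff_ker.2 fun v hv => mulVec_injective_iff_ker.1 h v ?_
      simp only [transpose_fromCols, fromRows_mulVec] at hv ⊢
      ext (i | i)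
      · exact congrFun hv (.inl i)
      · exact congrFun hv (.inr (.inr i))

theorem eq_neg_conjTranspose_of_ite {κ : Type*} (r : κ → κ → Prop)
    [DecidableRel r] : (of fun i j => (if r i j then 1 else 0) - (if r j i then 1 else 0) :
      Matrix κ κ 𝕜) = -(of fun i j => (if r i j then 1 else 0) - (if r j i then 1 else 0))ᴴ := by
  ext i j
  simp only [of_apply, Matrix.neg_apply, conjTranspose_apply, star_sub, apply_ite star, star_one,
    star_zero, neg_sub]

theorem genericOnSigma_fullRankEAB :
    GenericOnSigma (FullRankEAB : Matrix (Fin ℓ) (Fin n) 𝕜 → Matrix (Fin ℓ) (Fin n) 𝕜 →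
      Matrix (Fin ℓ) (Fin m) 𝕜 → Prop) := by
  -- `J` shifts indices by `n`, so [E, JE, B] becomes a matrix of consecutive unit columns. The skew
  -- counterparts of the shift entries lie in columns of index at least `n`, which multiplication by
  -- E discards.
  let J : Matrix (Fin ℓ) (Fin ℓ) 𝕜 :=
    of fun i j => (if (i : ℕ) = n + j then 1 else 0) - (if (j : ℕ) = n + i then 1 else 0)
  have hJ : J = -Jᴴ := eq_neg_conjTranspose_of_ite fun i j : Fin ℓ => (i : ℕ) = n + j
  have hJE : J * unitCols 𝕜 ℓ (fun c : Fin n => (c : ℕ)) =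
      unitCols 𝕜 ℓ (fun c : Fin n => n + c) := by
    ext i c
    rw [mul_unitCols_val]
    simp only [extendZero, J, of_apply, unitCols]
    split_ifs <;> first | omega | simp
  refine .of_hasFullRank (N := fun E A B => fromCols E (fromCols A B))
    (fun _ _ _ _ _ _ _ hE hA hB => hE.fromCols (hA.fromCols hB)) (fun E A B h => ?_) hJ
    (E₁ := unitCols 𝕜 ℓ fun c : Fin n => (c : ℕ))
    (B₁ := unitCols 𝕜 ℓ fun c : Fin m => 2 * n + c) ?_
  · have := h.rank_eq
    simp only [Fintype.card_sum, Fintype.card_fin, ← add_assoc, ← two_mul] at this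
    exact this
  · rw [hJE]
    exact hasFullRank_fromCols_fromCols_unitCols n m

/-- A polynomial matrix that is injective at some point is injective over the field of rational
functions. -/
theorem mulVec_injective_ratFunc {ι κ : Type*} [Fintype ι] [Fintype κ]
    {M : Matrix ι κ (Polynomial 𝕜)} (c : 𝕜)
    (h : Function.Injective (M.map (Polynomial.eval c)).mulVec) :
    Function.Injective (M.map (algebraMap (Polynomial 𝕜) (RatFunc 𝕜))).mulVec := by
  classical
  -- A constant left factor: the determinant of `L * M` takes at `c` the value det(M(c)ᴴ M(c)),
  -- which is nonzero.
  let L : Matrix κ ι (Polynomial 𝕜) := ((M.map (Polynomial.eval c))ᴴ).map Polynomial.C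
  have hdet : (L * M).det ≠ 0 := by
    intro h0
    have h1 := (det_conjTranspose_mul_self_ne_zero_iff _).2 h
    apply h1
    have h2 : (M.map (Polynomial.eval c))ᴴ * M.map (Polynomial.eval c) =
        (Polynomial.evalRingHom c).mapMatrix (L * M) := by
      rw [RingHom.mapMatrix_apply, Matrix.map_mul]
      congr 1
      ext i j
      simp [L]
    rw [h2, ← RingHom.map_det, h0, map_zero]
  have hdet' : ((L * M).map (algebraMap (Polynomial 𝕜) (RatFunc 𝕜))).det ≠ 0 := by
    rw [← RingHom.mapMatrix_apply, ← RingHom.map_det]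
    exact (map_ne_zero_iff _ (RatFunc.algebraMap_injective 𝕜)).2 hdet
  rw [Matrix.map_mul] at hdet'
  have hu := Matrix.mulVec_injective_of_isUnit ((Matrix.isUnit_iff_isUnit_det _).2 hdet'.isUnit)
  intro x y hxy
  apply hu
  simp only [← Matrix.mulVec_mulVec, hxy]

/-- E - A is the value of the pencil at x = 1, and independence at one point implies independence
over the rational functions. -/
theorem fullRankPencil_of_hasFullRank {E A : Matrix (Fin ℓ) (Fin n) 𝕜}
    {B : Matrix (Fin ℓ) (Fin m) 𝕜} (h : HasFullRank (fromCols (E - A) B)) :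
    FullRankPencil E A B := by
  let M : Matrix (Fin ℓ) (Fin n ⊕ Fin m) (Polynomial 𝕜) :=
    fromCols (of fun i j => Polynomial.X * Polynomial.C (E i j) - Polynomial.C (A i j))
      (B.map Polynomial.C)
  have h1 : M.map (Polynomial.eval 1) = fromCols (E - A) B := by
    ext i (j | j) <;> simp [M]
  have h2 : M.map (algebraMap (Polynomial 𝕜) (RatFunc 𝕜)) =
      fromCols ((RatFunc.X : RatFunc 𝕜) • E.map RatFunc.C - A.map RatFunc.C)
        (B.map RatFunc.C) := by
    ext i (j | j)
    · simp [M, mul_comm (RatFunc.C (E i j))]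
    · simp [M]
  have h3 : HasFullRank (M.map (algebraMap (Polynomial 𝕜) (RatFunc 𝕜))) := by
    rw [← h1] at h
    exact h.imp (mulVec_injective_ratFunc 1) (mulVec_injective_ratFunc (M := Mᵀ) 1)
  have := h3.rank_eq
  rw [h2] at this
  simpa [FullRankPencil] using this

theorem genericOnSigma_fullRankPencil :
    GenericOnSigma (FullRankPencil : Matrix (Fin ℓ) (Fin n) 𝕜 → Matrix (Fin ℓ) (Fin n) 𝕜 →
      Matrix (Fin ℓ) (Fin m) 𝕜 → Prop) :=
  .of_hasFullRank (N := fun E A B => fromCols (E - A) B)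
    (fun _ _ _ _ _ _ _ hE hA hB => (hE.sub hA).fromCols hB)
    (fun _ _ _ h => fullRankPencil_of_hasFullRank h) (J₁ := 0) (by simp)
    (by simpa using hasFullRank_fromCols_unitCols n m)

theorem genericOnSigma_fullRankEB :
    GenericOnSigma fun (E : Matrix (Fin ℓ) (Fin n) 𝕜) (_ : Matrix (Fin ℓ) (Fin n) 𝕜)
      (B : Matrix (Fin ℓ) (Fin m) 𝕜) => FullRankEB E B :=
  genericOnSigma_hasFullRank_EB.mono fun _ _ _ => fullRankEB_of_hasFullRank

theorem genericOnSigma_fullRankKernel :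
    GenericOnSigma (FullRankKernel : Matrix (Fin ℓ) (Fin n) 𝕜 → Matrix (Fin ℓ) (Fin n) 𝕜 →
      Matrix (Fin ℓ) (Fin m) 𝕜 → Prop) :=
  genericOnSigma_hasFullRank_EB.mono fun _ _ _ => fullRankKernel_of_hasFullRank

end Constant

/-! ### The pointwise rank condition on the pencil -/

section Pointwise

open Matrix

/-! ### Chain matrices, which eliminate the parameter λ. -/

/-- The matrix of the linear map `x ↦ x ∘ f`. -/
def selectRows {α β : Type*} [DecidableEq β] (f : α → β) : Matrix α β ℂ :=
  of fun i j => if j = f i then 1 else 0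

theorem selectRows_kronecker_mulVec {α β ι κ : Type*} [Fintype β] [DecidableEq β] [Fintype κ]
    (f : α → β) (M : Matrix ι κ ℂ) (x : β × κ → ℂ) (i : α) (j : ι) :
    (kroneckerMap (· * ·) (selectRows f) M *ᵥ x) (i, j) = (M *ᵥ fun s => x (f i, s)) j := by
  simp [mulVec, dotProduct, selectRows, Fintype.sum_prod_type]

variable {ℓ n m : ℕ}

/-- The block matrix of `(w₀, …, w_k) ↦ (w_{i+1} E - w_i A, w_i B)`, for row vectors `w_i`. -/
def rowChain (k : ℕ) (E A : Matrix (Fin ℓ) (Fin n) ℂ) (B : Matrix (Fin ℓ) (Fin m) ℂ) :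
    Matrix ((Fin k × Fin n) ⊕ (Fin (k + 1) × Fin m)) (Fin (k + 1) × Fin ℓ) ℂ :=
  fromRows (kroneckerMap (· * ·) (selectRows Fin.succ) Eᵀ -
    kroneckerMap (· * ·) (selectRows Fin.castSucc) Aᵀ) (kroneckerMap (· * ·) (selectRows id) Bᵀ)

/-- The block matrix of `(x₀, …, x_k, y₀, …, y_{k-1}) ↦ E x_{i+1} - A x_i + B y_i`. -/
def colChain (k : ℕ) (E A : Matrix (Fin ℓ) (Fin n) ℂ) (B : Matrix (Fin ℓ) (Fin m) ℂ) :
    Matrix (Fin k × Fin ℓ) ((Fin (k + 1) × Fin n) ⊕ (Fin k × Fin m)) ℂ :=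
  fromCols (kroneckerMap (· * ·) (selectRows Fin.succ) E -
    kroneckerMap (· * ·) (selectRows Fin.castSucc) A) (kroneckerMap (· * ·) (selectRows id) B)

theorem rowChain_mulVec_eq_zero_iff {k : ℕ} {E A : Matrix (Fin ℓ) (Fin n) ℂ}
    {B : Matrix (Fin ℓ) (Fin m) ℂ} {x : Fin (k + 1) × Fin ℓ → ℂ} :
    rowChain k E A B *ᵥ x = 0 ↔
      (∀ i : Fin k, Eᵀ *ᵥ (fun s => x (i.succ, s)) = Aᵀ *ᵥ (fun s => x (i.castSucc, s))) ∧
      ∀ i, Bᵀ *ᵥ (fun s => x (i, s)) = 0 := by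
  simp only [rowChain, fromRows_mulVec, sub_mulVec, funext_iff, Sum.forall, Prod.forall,
    Sum.elim_inl, Sum.elim_inr, Pi.sub_apply, selectRows_kronecker_mulVec, Pi.zero_apply,
    sub_eq_zero, id]

theorem colChain_mulVec_eq_zero_iff {k : ℕ} {E A : Matrix (Fin ℓ) (Fin n) ℂ}
    {B : Matrix (Fin ℓ) (Fin m) ℂ} {x : (Fin (k + 1) × Fin n) ⊕ (Fin k × Fin m) → ℂ} :
    colChain k E A B *ᵥ x = 0 ↔ ∀ i : Fin k, E *ᵥ (fun s => x (.inl (i.succ, s))) -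
      A *ᵥ (fun s => x (.inl (i.castSucc, s))) + B *ᵥ (fun s => x (.inr (i, s))) = 0 := by
  simp only [colChain, fromCols_mulVec, sub_mulVec, funext_iff, Prod.forall, Pi.add_apply,
    Pi.sub_apply, selectRows_kronecker_mulVec, Pi.zero_apply, id, Function.comp_apply]

/-- A left kernel vector v at z gives the chain w_i = zⁱ v, whose member w₀ is v itself. -/
theorem hasFullRank_of_rowChain {k : ℕ} {E A : Matrix (Fin ℓ) (Fin n) ℂ}
    {B : Matrix (Fin ℓ) (Fin m) ℂ} (h : Function.Injective (rowChain k E A B).mulVec) (z : ℂ) :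
    HasFullRank (fromCols (z • E - A) B) := by
  refine .inr (mulVec_injective_iff_ker.2 fun v hv => ?_)
  rw [transpose_fromCols, fromRows_mulVec] at hv
  have h1 : (z • E - A)ᵀ *ᵥ v = 0 := funext fun j => congrFun hv (.inl j)
  have h2 : Bᵀ *ᵥ v = 0 := funext fun j => congrFun hv (.inr j)
  rw [transpose_sub, transpose_smul, sub_mulVec, smul_mulVec, sub_eq_zero] at h1
  have hz : ∀ a : ℕ, (fun s => z ^ a * v s) = z ^ a • v := fun a => rfl
  have := mulVec_injective_iff_ker.1 h (fun p => z ^ (p.1 : ℕ) * v p.2)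
    (rowChain_mulVec_eq_zero_iff.2 ⟨fun i => ?_, fun i => ?_⟩)
  · ext s
    simpa using congrFun this (0, s)
  · simp only [hz, mulVec_smul, ← h1, Fin.val_succ, Fin.val_castSucc]
    rw [smul_smul, pow_succ]
  · simp only [hz, mulVec_smul, h2, smul_zero]

/-- The same geometric chain for right kernel vectors. `0 < k` is needed to recover the B-part of
the vector, as y₀ exists only then. -/
theorem hasFullRank_of_colChain {k : ℕ} (hk : 0 < k) {E A : Matrix (Fin ℓ) (Fin n) ℂ}
    {B : Matrix (Fin ℓ) (Fin m) ℂ} (h : Function.Injective (colChain k E A B).mulVec) (z : ℂ) :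
    HasFullRank (fromCols (z • E - A) B) := by
  refine .inl (mulVec_injective_iff_ker.2 fun v hv => ?_)
  rw [fromCols_mulVec, sub_mulVec, smul_mulVec] at hv
  have hz : ∀ (a : ℕ) {κ : Type} (v : κ → ℂ), (fun s => z ^ a * v s) = z ^ a • v :=
    fun _ _ _ => rfl
  have := mulVec_injective_iff_ker.1 h (Sum.elim (fun p => z ^ (p.1 : ℕ) * (v ∘ Sum.inl) p.2)
    (fun p => z ^ (p.1 : ℕ) * (v ∘ Sum.inr) p.2)) (colChain_mulVec_eq_zero_iff.2 fun i => ?_)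
  · ext (s | s)
    · simpa using congrFun this (.inl (0, s))
    · simpa using congrFun this (.inr (⟨0, hk⟩, s))
  · simp only [Sum.elim_inl, Sum.elim_inr, hz, mulVec_smul, Fin.val_succ, Fin.val_castSucc]
    rw [pow_succ, mul_smul, ← smul_sub, ← smul_add, hv, smul_zero]

/-! ### Tridiagonal witnesses for ℓ ≠ n + m. -/

/-- A doubly indexed family obeying the three-term recursion of the tridiagonal skew-symmetric
matrix, vanishing on its boundary, is zero. -/
theorem eq_zero_of_tridiagonal_chain {k p : ℕ} {Y : ℕ → ℕ → ℂ} (hp : p ≤ k)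
    (h₀ : ∀ a < k, Y a 0 = 0) (h₁ : ∀ a ≤ k, ∀ s, p ≤ s → Y a s = 0)
    (h₂ : ∀ a < k, ∀ j < p, Y (a + 1) j = (if 0 < j then Y a (j - 1) else 0) - Y a (j + 1)) :
    ∀ a ≤ k, ∀ s, Y a s = 0 := by
  -- Solving the recursion for Y a (j + 1) trades one unit of s for one step in a, hence the
  -- triangle a + s < k.
  have key : ∀ s a, a + s < k → Y a s = 0 := by
    intro s
    induction s using Nat.strong_induction_on with
    | _ s ih =>
      intro a ha
      rcases s with _ | j
      · exact h₀ a (by omega)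
      · rcases le_or_gt p (j + 1) with hj | hj
        · exact h₁ a (by omega) _ hj
        · have h := h₂ a (by omega) j (by omega)
          rw [ih j (by omega) (a + 1) (by omega)] at h
          split_ifs at h with hj0
          · rw [ih (j - 1) (by omega) a (by omega)] at h
            simpa using h
          · simpa using h
  -- As `p ≤ k`, the triangle covers all of row a = 0; the recursion then carries the vanishing to
  -- larger a.
  intro a
  induction a with
  | zero =>
    intro h0 s
    rcases le_or_gt p s with hs | hs
    · exact h₁ 0 h0 s hs
    · exact key s 0 (by omega)
  | succ a ih =>
    intro ha s
    rcases le_or_gt p s with hs | hs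
    · exact h₁ _ ha s hs
    · rw [h₂ a (by omega) s hs, ih (by omega), ih (by omega)]
      simp

/-- The tridiagonal skew-symmetric matrix with entries `1` above the diagonal. -/
def tridiagonal (F : Type*) [Field F] (ℓ : ℕ) : Matrix (Fin ℓ) (Fin ℓ) F :=
  of fun i j => (if (i : ℕ) + 1 = j then 1 else 0) - (if (j : ℕ) + 1 = i then 1 else 0)

theorem tridiagonal_eq_neg_conjTranspose {𝕜 : Type*} [RCLike 𝕜] :
    tridiagonal 𝕜 ℓ = -(tridiagonal 𝕜 ℓ)ᴴ :=
  eq_neg_conjTranspose_of_ite fun i j : Fin ℓ => (i : ℕ) + 1 = j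

variable {𝕜 : Type*} [RCLike 𝕜]

theorem rclike_map_zero_one : RCLike.map 𝕜 ℂ 0 = 0 ∧ RCLike.map 𝕜 ℂ 1 = 1 := by simp

theorem unitCols_map {κ : Type*} (g : κ → ℕ) :
    (unitCols 𝕜 ℓ g).map (RCLike.map 𝕜 ℂ) = unitCols ℂ ℓ g := by
  ext i c
  simp only [unitCols, map_apply, of_apply, apply_ite (RCLike.map 𝕜 ℂ), rclike_map_zero_one]

theorem tridiagonal_mul_unitCols_map_apply (i : Fin ℓ) (c : Fin n) (hc : (c : ℕ) < ℓ) :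
    ((tridiagonal 𝕜 ℓ * unitCols 𝕜 ℓ fun c : Fin n => (c : ℕ)).map (RCLike.map 𝕜 ℂ)) i c =
      (if (i : ℕ) + 1 = c then 1 else 0) - (if (c : ℕ) + 1 = i then 1 else 0) := by
  rw [map_apply, mul_unitCols_val, extendZero, dif_pos hc]
  simp only [tridiagonal, of_apply, map_sub, apply_ite (RCLike.map 𝕜 ℂ), rclike_map_zero_one]

/-- The columns of B are e₀ and e_n, …, e_{n+m-2}. They annihilate entry 0 and, because ℓ ≤ n + m -
1, all entries from n on: exactly the boundary values of the recursion. -/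
theorem rowChain_tridiagonal_injective (hm : 0 < m) (h : ℓ < n + m) :
    Function.Injective (rowChain ℓ
      ((unitCols 𝕜 ℓ fun c : Fin n => (c : ℕ)).map (RCLike.map 𝕜 ℂ))
      ((tridiagonal 𝕜 ℓ * unitCols 𝕜 ℓ fun c : Fin n => (c : ℕ)).map (RCLike.map 𝕜 ℂ))
      ((unitCols 𝕜 ℓ fun c : Fin m => if (c : ℕ) = 0 then 0 else n + c - 1).map
        (RCLike.map 𝕜 ℂ))).mulVec := by
  refine mulVec_injective_iff_ker.2 fun x hx => ?_
  rw [rowChain_mulVec_eq_zero_iff, unitCols_map, unitCols_map] at hx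
  obtain ⟨hx₁, hx₂⟩ := hx
  let Y : ℕ → ℕ → ℂ := fun a s =>
    if ha : a < ℓ + 1 then extendZero (fun s => x (⟨a, ha⟩, s)) s else 0
  have hY : ∀ a ≤ ℓ, ∀ s, Y a s = 0 := by
    -- `n` may exceed `ℓ`; the entries of index at least `ℓ` vanish by extension.
    refine eq_zero_of_tridiagonal_chain (p := min n ℓ) (min_le_right _ _) ?_ ?_ ?_
    · intro a ha
      have := congrFun (hx₂ ⟨a, by omega⟩) ⟨0, hm⟩
      rw [transpose_unitCols_mulVec] at this
      simpa [Y, ha.le] using this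
    · intro a ha s hs
      rcases le_or_gt ℓ s with hs' | hs'
      · simp only [Y]
        split_ifs
        · exact extendZero_of_le _ hs'
        · rfl
      · have := congrFun (hx₂ ⟨a, by omega⟩) ⟨s - n + 1, by omega⟩
        rw [transpose_unitCols_mulVec] at this
        have hs2 : n + (s - n + 1) - 1 = s := by omega
        simpa [Y, ha, hs2] using this
    · intro a ha j hj
      have := congrFun (hx₁ ⟨a, ha⟩) ⟨j, by omega⟩
      rw [transpose_unitCols_mulVec] at this
      simp only [Y, show a + 1 < ℓ + 1 by omega, show a < ℓ + 1 by omega, dif_pos]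
      refine this.trans ?_
      simp only [mulVec, dotProduct]
      rw [← sum_ite_val_add_one_eq, ← sum_ite_val_eq, ← Finset.sum_sub_distrib]
      refine Finset.sum_congr rfl fun i _ => ?_
      rw [transpose_apply, tridiagonal_mul_unitCols_map_apply _ _ (by simp; omega), sub_mul]
      congr 3
      simp only [eq_iff_iff]
      exact eq_comm
  ext ⟨a, s⟩
  have := hY a (by omega) s
  simp only [Y, a.2, dif_pos] at this
  rwa [extendZero_val] at this

/-- B occupies rows n + 1, …, n + m, available as n + m < ℓ. Rows below n give the recursion for x,
and the free row n forces its last entry to vanish. Once x = 0, independence of the columns of B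
gives y = 0. -/
theorem colChain_tridiagonal_injective (hn : 0 < n) (h : n + m < ℓ) :
    Function.Injective (colChain n
      ((unitCols 𝕜 ℓ fun c : Fin n => (c : ℕ)).map (RCLike.map 𝕜 ℂ))
      ((tridiagonal 𝕜 ℓ * unitCols 𝕜 ℓ fun c : Fin n => (c : ℕ)).map (RCLike.map 𝕜 ℂ))
      ((unitCols 𝕜 ℓ fun c : Fin m => n + 1 + c).map (RCLike.map 𝕜 ℂ))).mulVec := by
  refine mulVec_injective_iff_ker.2 fun x hx => ?_
  rw [colChain_mulVec_eq_zero_iff, unitCols_map, unitCols_map] at hx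
  let X : ℕ → ℕ → ℂ := fun a s =>
    if ha : a < n + 1 then extendZero (fun s => x (.inl (⟨a, ha⟩, s))) s else 0
  have hX : ∀ a s, n ≤ s → X a s = 0 := by
    intro a s hs
    simp only [X]
    split_ifs
    · exact extendZero_of_le _ hs
    · rfl
  have hA : ∀ (a : Fin n) (r : Fin ℓ),
      (((tridiagonal 𝕜 ℓ * unitCols 𝕜 ℓ fun c : Fin n => (c : ℕ)).map (RCLike.map 𝕜 ℂ)) *ᵥ
        fun s => x (.inl (a.castSucc, s))) r =
        X a (r + 1) - if 0 < (r : ℕ) then X a (r - 1) else 0 := by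
    intro a r
    simp only [X, show (a : ℕ) < n + 1 by omega, dif_pos, mulVec, dotProduct]
    rw [← sum_ite_val_add_one_eq, ← sum_ite_val_eq, ← Finset.sum_sub_distrib]
    refine Finset.sum_congr rfl fun i _ => ?_
    rw [tridiagonal_mul_unitCols_map_apply _ _ (by omega), sub_mul]
    congr 3
    simp only [eq_iff_iff]
    exact eq_comm
  have hrow : ∀ a : Fin n, ∀ r (hr : r < ℓ), r ≤ n →
      X (a + 1) r = X a (r + 1) - if 0 < r then X a (r - 1) else 0 := by
    intro a r hr hrn
    have := congrFun (hx a) ⟨r, hr⟩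
    rw [Pi.add_apply, Pi.sub_apply, hA, unitCols_mulVec_eq_zero (g := fun c : Fin m => n + 1 + ↑c)
      _ (by intro c; simp; omega)] at this
    rw [Pi.zero_apply, add_zero, sub_eq_zero] at this
    rw [← this]
    rcases lt_or_ge r n with hrn' | hrn'
    · have h2 := unitCols_mulVec (F := ℂ) (ℓ := ℓ) (g := fun c : Fin n => (c : ℕ))
        Fin.val_injective (fun s => x (.inl (a.succ, s))) (c := ⟨r, hrn'⟩) hr
      rw [h2]
      simp only [X, extendZero, hrn', dif_pos, show (a : ℕ) + 1 < n + 1 by omega]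
      rfl
    · rw [hX _ _ hrn', unitCols_mulVec_eq_zero]
      intro c
      simp
      omega
  -- The known boundary value sits at index n - 1; reversing the order moves it to 0 and also turns
  -- the signs into those of the chain lemma.
  let Y : ℕ → ℕ → ℂ := fun a s => if s < n then X a (n - 1 - s) else 0
  have hY : ∀ a ≤ n, ∀ s, Y a s = 0 := by
    refine eq_zero_of_tridiagonal_chain (p := n) le_rfl ?_ ?_ ?_
    · intro a ha
      have := hrow ⟨a, ha⟩ n (by omega) le_rfl
      rw [hX _ _ le_rfl, hX _ _ (by omega), if_pos hn, zero_sub, zero_eq_neg] at this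
      simpa [Y, hn] using this
    · intro a _ s hs
      simp [Y, hs]
    · intro a ha j hj
      have := hrow ⟨a, ha⟩ (n - 1 - j) (by omega) (by omega)
      simp only [Y, hj, if_true]
      rw [this]
      congr 1
      · rcases Nat.eq_zero_or_pos j with rfl | hj0
        · rw [if_neg (lt_irrefl 0)]
          exact hX _ _ (by omega)
        · rw [if_pos hj0, if_pos (by omega)]
          congr 1
          omega
      · rcases lt_or_ge (j + 1) n with hj1 | hj1
        · rw [if_pos (by omega), if_pos hj1]
          congr 1
        · rw [if_neg (by omega), if_neg (by omega)]
  have hX0 : ∀ a ≤ n, ∀ s, X a s = 0 := by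
    intro a ha s
    rcases lt_or_ge s n with hs | hs
    · have := hY a ha (n - 1 - s)
      simp only [Y] at this
      rw [if_pos (by omega)] at this
      rwa [show n - 1 - (n - 1 - s) = s by omega] at this
    · exact hX a s hs
  have hx0 : ∀ a s, x (.inl (a, s)) = 0 := by
    intro a s
    have := hX0 a (by omega) s
    simp only [X, a.2, dif_pos] at this
    rwa [extendZero_val] at this
  ext (⟨a, s⟩ | ⟨a, s⟩)
  · exact hx0 a s
  · have := hx a
    simp only [hx0] at this
    have hz : (fun _ : Fin n => (0 : ℂ)) = 0 := rfl
    rw [hz, mulVec_zero, mulVec_zero, sub_zero, zero_add] at this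
    have h2 := unitCols_mulVec (F := ℂ) (ℓ := ℓ) (g := fun c : Fin m => n + 1 + ↑c)
      (fun a b hab => Fin.ext (by simpa using hab)) (fun s => x (.inr (a, s))) (c := s) (by omega)
    rw [this] at h2
    exact h2.symm

theorem fullRankPointwise_of_hasFullRank {E A : Matrix (Fin ℓ) (Fin n) 𝕜}
    {B : Matrix (Fin ℓ) (Fin m) 𝕜}
    (h : ∀ z : ℂ, HasFullRank (fromCols (z • E.map (RCLike.map 𝕜 ℂ) - A.map (RCLike.map 𝕜 ℂ))
      (B.map (RCLike.map 𝕜 ℂ)))) : FullRankPointwise E A B := by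
  intro z
  simpa using (h z).rank_eq

theorem genericOnSigma_fullRankPointwise (hn : 0 < n) (hm : 0 < m) (h : ℓ ≠ n + m) :
    GenericOnSigma (FullRankPointwise : Matrix (Fin ℓ) (Fin n) 𝕜 →
      Matrix (Fin ℓ) (Fin n) 𝕜 → Matrix (Fin ℓ) (Fin m) 𝕜 → Prop) := by
  rcases lt_or_gt_of_ne h with h | h
  · exact .of_injective (N := fun E A B => rowChain ℓ (E.map (RCLike.map 𝕜 ℂ))
      (A.map (RCLike.map 𝕜 ℂ)) (B.map (RCLike.map 𝕜 ℂ)))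
      (fun _ _ _ _ _ _ _ hE hA hB => .fromRows (.sub (.kronecker _ hE.map.transpose)
        (.kronecker _ hA.map.transpose)) (.kronecker _ hB.map.transpose))
      (fun E A B hinj => fullRankPointwise_of_hasFullRank (hasFullRank_of_rowChain hinj))
      tridiagonal_eq_neg_conjTranspose (rowChain_tridiagonal_injective hm h)
  · exact .of_injective (N := fun E A B => colChain n (E.map (RCLike.map 𝕜 ℂ))
      (A.map (RCLike.map 𝕜 ℂ)) (B.map (RCLike.map 𝕜 ℂ)))
      (fun _ _ _ _ _ _ _ hE hA hB => .fromCols (.sub (.kronecker _ hE.map)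
        (.kronecker _ hA.map)) (.kronecker _ hB.map))
      (fun E A B hinj => fullRankPointwise_of_hasFullRank (hasFullRank_of_colChain hn hinj))
      tridiagonal_eq_neg_conjTranspose (colChain_tridiagonal_injective hn h)

/-! ### The square case ℓ = n + m. -/

/-- If `[E, B]` is square and invertible, then `[z E - A, B]` is singular for some `z`. -/
theorem exists_rank_pencil_lt (hn : 0 < n) (h : ℓ = n + m) {E A : Matrix (Fin ℓ) (Fin n) ℂ}
    {B : Matrix (Fin ℓ) (Fin m) ℂ} (hEB : HasFullRank (fromCols E B)) :
    ∃ z : ℂ, (fromCols (z • E - A) B).rank < n + m := by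
  have hr := hEB.rank_eq
  simp only [Fintype.card_sum, Fintype.card_fin, h, min_self] at hr
  have hsurj : Function.Surjective (fromCols E B).mulVecLin := by
    rw [← LinearMap.range_eq_top]
    refine Submodule.eq_top_of_finrank_eq ?_
    rw [Module.finrank_fintype_fun_eq_card, Fintype.card_fin]
    exact hr.trans h.symm
  obtain ⟨G, hG⟩ := (fromCols E B).mulVecLin.exists_rightInverse_of_surjective
    (LinearMap.range_eq_top.2 hsurj)
  have : Nonempty (Fin n) := ⟨⟨0, hn⟩⟩
  -- `T` is the E-block of [E, B]⁻¹A. An eigenvector x for z means Ax = zEx + By for some y, so (x,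
  -- y) lies in the kernel of [zE - A, B]; 0 < n provides the eigenvalue.
  let T : Module.End ℂ (Fin n → ℂ) := LinearMap.funLeft ℂ ℂ Sum.inl ∘ₗ G ∘ₗ A.mulVecLin
  obtain ⟨z, hz⟩ := Module.End.exists_eigenvalue T
  obtain ⟨x, hx⟩ := hz.exists_hasEigenvector
  refine ⟨z, lt_of_not_ge fun hge => ?_⟩
  have hinj : Function.Injective (fromCols (z • E - A) B).mulVecLin := by
    rw [← LinearMap.ker_eq_bot, ← Submodule.finrank_eq_zero]
    have := (fromCols (z • E - A) B).mulVecLin.finrank_range_add_finrank_ker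
    rw [Module.finrank_fintype_fun_eq_card, Fintype.card_sum, Fintype.card_fin,
      Fintype.card_fin] at this
    change n + m ≤ Module.finrank ℂ _ at hge
    omega
  let y : Fin n ⊕ Fin m → ℂ := G (A *ᵥ x)
  have hy₁ : y ∘ Sum.inl = z • x := hx.apply_eq_smul
  have hy₂ : fromCols E B *ᵥ y = A *ᵥ x := LinearMap.congr_fun hG (A *ᵥ x)
  rw [fromCols_mulVec, hy₁, mulVec_smul] at hy₂
  have h0 := (injective_iff_map_eq_zero _).1 hinj (Sum.elim x (y ∘ Sum.inr)) (by
    rw [mulVecLin_apply, fromCols_mulVec, Sum.elim_comp_inl, Sum.elim_comp_inr, sub_mulVec,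
      smul_mulVec, ← hy₂]
    abel)
  exact hx.2 (funext fun i => congrFun h0 (.inl i))

/-- The rank drops somewhere as soon as [E, B] is invertible, whatever A is, so J₁ = 0 suffices. -/
theorem genericOnSigma_not_fullRankPointwise (hn : 0 < n) (h : ℓ = n + m) :
    GenericOnSigma fun (E A : Matrix (Fin ℓ) (Fin n) 𝕜) (B : Matrix (Fin ℓ) (Fin m) 𝕜) =>
      ¬ FullRankPointwise E A B := by
  refine .of_hasFullRank
    (N := fun E _ B => fromCols (E.map (RCLike.map 𝕜 ℂ)) (B.map (RCLike.map 𝕜 ℂ)))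
    (fun _ _ _ _ _ _ _ hE _ hB => hE.map.fromCols hB.map) (fun E A B hEB hP => ?_) (J₁ := 0)
    (E₁ := unitCols 𝕜 ℓ fun c : Fin n => (c : ℕ)) (B₁ := unitCols 𝕜 ℓ fun c : Fin m => n + c)
    (by simp) ?_
  · obtain ⟨z, hz⟩ := exists_rank_pencil_lt hn h (A := A.map (RCLike.map 𝕜 ℂ)) hEB
    have := hP z
    omega
  · rw [unitCols_map, unitCols_map]
    exact hasFullRank_fromCols_unitCols n m

end Pointwise

/-! ### Nonemptiness of the reference sets and conclusion. -/

theorem zero_mem_sigmaH (𝕜 : Type*) [RCLike 𝕜] (ℓ n m : ℕ) :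
    (0 : Quadruple 𝕜 ℓ n m) ∈ SigmaH 𝕜 ℓ n m :=
  ⟨by simp, by simp, by simpa using Matrix.PosSemidef.zero⟩

theorem zero_mem_sigmaSdH (𝕜 : Type*) [RCLike 𝕜] (ℓ n m : ℕ) :
    (0 : Quintuple 𝕜 ℓ n m) ∈ SigmaSdH 𝕜 ℓ n m :=
  ⟨by simp, ⟨by simp, Matrix.PosSemidef.zero⟩, by simp, by simpa using Matrix.PosSemidef.zero⟩

theorem compl_Si (𝕜 : Type*) [RCLike 𝕜] (ℓ n m : ℕ) : (Si 𝕜 ℓ n m)ᶜ =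
    {(E, J, Q, B) : Quadruple 𝕜 ℓ n m | ¬ FullRankPointwise E (J * Q) B} :=
  Set.ext fun ⟨_, _, _, _⟩ => Iff.rfl

theorem compl_Sj (𝕜 : Type*) [RCLike 𝕜] (ℓ n m : ℕ) : (Sj 𝕜 ℓ n m)ᶜ =
    {(E, J, R, Q, B) : Quintuple 𝕜 ℓ n m | ¬ FullRankPointwise E ((J - R) * Q) B} :=
  Set.ext fun ⟨_, _, _, _, _⟩ => Iff.rfl

theorem isRelGeneric_compl_Si {𝕜 : Type*} [RCLike 𝕜] {ℓ n m : ℕ} (hn : 0 < n) (h : ℓ = n + m) :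
    IsRelGeneric (Si 𝕜 ℓ n m)ᶜ (SigmaH 𝕜 ℓ n m) := by
  rw [compl_Si]
  exact (genericOnSigma_not_fullRankPointwise hn h).1

theorem isRelGeneric_compl_Sj {𝕜 : Type*} [RCLike 𝕜] {ℓ n m : ℕ} (hn : 0 < n) (h : ℓ = n + m) :
    IsRelGeneric (Sj 𝕜 ℓ n m)ᶜ (SigmaSdH 𝕜 ℓ n m) := by
  rw [compl_Sj]
  exact (genericOnSigma_not_fullRankPointwise hn h).2 _ (.inl rfl)

end PortHamiltonian

end

theorem mainTheorem3 (𝕜 : Type*) [RCLike 𝕜] (ℓ n m : ℕ) (hℓ : 0 < ℓ) (hn : 0 < n) (hm : 0 < m) :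
    (PortHamiltonian.IsRelGeneric (PortHamiltonian.Sa 𝕜 ℓ n m) (PortHamiltonian.SigmaH 𝕜 ℓ n m) ∧
     PortHamiltonian.IsRelGeneric (PortHamiltonian.Sb 𝕜 ℓ n m) (PortHamiltonian.SigmaH 𝕜 ℓ n m) ∧
     PortHamiltonian.IsRelGeneric (PortHamiltonian.Sc 𝕜 ℓ n m) (PortHamiltonian.SigmaH 𝕜 ℓ n m) ∧
     PortHamiltonian.IsRelGeneric (PortHamiltonian.Sd 𝕜 ℓ n m) (PortHamiltonian.SigmaH 𝕜 ℓ n m)) ∧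
    (∀ V ∈ ({PortHamiltonian.SigmaSdH 𝕜 ℓ n m, PortHamiltonian.SigmaDH 𝕜 ℓ n m} :
        Set (Set (PortHamiltonian.Quintuple 𝕜 ℓ n m))),
      PortHamiltonian.IsRelGeneric (PortHamiltonian.Se 𝕜 ℓ n m) V ∧
      PortHamiltonian.IsRelGeneric (PortHamiltonian.Sf 𝕜 ℓ n m) V ∧
      PortHamiltonian.IsRelGeneric (PortHamiltonian.Sg 𝕜 ℓ n m) V ∧
      PortHamiltonian.IsRelGeneric (PortHamiltonian.Sh 𝕜 ℓ n m) V) ∧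
    ((PortHamiltonian.IsRelGeneric (PortHamiltonian.Si 𝕜 ℓ n m)
        (PortHamiltonian.SigmaH 𝕜 ℓ n m) ↔ ℓ ≠ n + m) ∧
     (ℓ = n + m → PortHamiltonian.IsRelGeneric (PortHamiltonian.Si 𝕜 ℓ n m)ᶜ
        (PortHamiltonian.SigmaH 𝕜 ℓ n m))) ∧
    ((PortHamiltonian.IsRelGeneric (PortHamiltonian.Sj 𝕜 ℓ n m)
        (PortHamiltonian.SigmaSdH 𝕜 ℓ n m) ↔ ℓ ≠ n + m) ∧
     (ℓ = n + m → PortHamiltonian.IsRelGeneric (PortHamiltonian.Sj 𝕜 ℓ n m)ᶜ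
        (PortHamiltonian.SigmaSdH 𝕜 ℓ n m))) := by
  refine ⟨⟨?_, ?_, ?_, ?_⟩, fun V hV => ⟨?_, ?_, ?_, ?_⟩,
    ⟨⟨fun hS h => ?_, fun h => ?_⟩, PortHamiltonian.isRelGeneric_compl_Si hn⟩,
    ⟨fun hS h => ?_, fun h => ?_⟩, PortHamiltonian.isRelGeneric_compl_Sj hn⟩
  · exact PortHamiltonian.genericOnSigma_fullRankEB.1
  · exact PortHamiltonian.genericOnSigma_fullRankEAB.1
  · exact PortHamiltonian.genericOnSigma_fullRankPencil.1
  · exact PortHamiltonian.genericOnSigma_fullRankKernel.1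
  · exact PortHamiltonian.genericOnSigma_fullRankEB.2 V hV
  · exact PortHamiltonian.genericOnSigma_fullRankEAB.2 V hV
  · exact PortHamiltonian.genericOnSigma_fullRankPencil.2 V hV
  · exact PortHamiltonian.genericOnSigma_fullRankKernel.2 V hV
  -- For ℓ = n + m the complement is generic, which excludes genericity of the set because the
  -- reference set contains 0.
  · exact hS.not_compl ⟨0, PortHamiltonian.zero_mem_sigmaH 𝕜 ℓ n m⟩
      (PortHamiltonian.isRelGeneric_compl_Si hn h)
  · exact (PortHamiltonian.genericOnSigma_fullRankPointwise hn hm h).1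
  · exact hS.not_compl ⟨0, PortHamiltonian.zero_mem_sigmaSdH 𝕜 ℓ n m⟩
      (PortHamiltonian.isRelGeneric_compl_Sj hn h)
  · exact (PortHamiltonian.genericOnSigma_fullRankPointwise hn hm h).2 _ (.inl rfl)
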